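/- Graphs are finite and loopless, and multiple edges are allowed. An edge is \emph{multiple} if another edge has the same endpoints, and \emph{simple} otherwise; a \emph{bundle} is a maximal set of multiple edges with the same endpoints; a graph is \emph{simple} if all its edges are simple. A subgraph $I$ of $H$ is \emph{semi-induced} if any two vertices of $I$ that are adjacent in $H$ are joined by at least one edge of $I$. A \emph{PI-graph} of $G$ is an induced subgraph of a graph obtained from $G$ by replacing some (possibly none) of its bundles with simple edges. Let $\mathcal C_H$ be the set of all vertices and all multiple edges of $H$. A set $A\subseteq\mathcal C_H$ is \emph{admissible} to a connected graph $H$ if $|A\cap V(H)|$ is even, every vertex of $H$ that is incident only to simple edges of $H$ is in $A$, and $|A\cap B|$ is even and nonzero for each bundle $B$ of $H$; it is admissible to a disconnected graph $H$ if $A\cap\mathcal C_{H'}$ is admissible to each component $H'$ of $H$. For $A$ admissible to $H$, let $\mathcal P^{\mathrm{even}}_{H,A}$ be the set of all semi-induced subgraphs $I$ of $H$ (including $\emptyset$ and $H$) each of whose components contains an even number of elements of $A$, ordered by subgraph containment. A finite poset is \emph{shellable} if the facets of its order complex can be ordered $F_1,\dots,F_t$ so that, for $k=2,\dots,t$, the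 complex $\bigl(\bigcup_{i<k}\overline{F_i}\bigr)\cap\overline{F_k}$ is pure of dimension $\dim F_k-1$, where $\overline{F}$ is the complex of all faces of $F$ (the complexes need not be pure). Let $\mathcal G^*$ be the family of all graphs $G$ such that $\mathcal P^{\mathrm{even}}_{H,A}$ is shellable for every PI-graph $H$ of $G$ and every $A$ admissible to $H$. For $m\ge 2$, define the following graphs on the vertices $0,1,\dots,n-1$, each of which has exactly $m$ edges between $0$ and $1$, all its other edges being simple. - $\tilde P_{n,m}$ ($n\ge2$): the other edges are $\{i,i+1\}$ for $1\le i\le n-2$. - $\tilde S_{n,m}$ ($n\ge5$ odd): the other edges are $\{i,i+1\}$ for $1\le i\le n-3$, and $\{n-3,n-1\}$. - $\tilde T_{n,m}$ ($n\ge5$ odd): $\tilde S_{n,m}$ with the edge $\{n-2,n-1\}$ added. - $\tilde P'_{n,m}$ ($n\ge3$), $\tilde S'_{n,m}$ and $\tilde T'_{n,m}$ ($n\ge5$ odd): the graphs $\tilde P_{n,m}$, $\tilde S_{n,m}$ and $\tilde T_{n,m}$, respectively, with the edge $\{0,2\}$ added. **Theorem.** Every connected non-simple graph in $\mathcal G^*$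 is isomorphic to one of the graphs $\tilde P_{n,m}$ ($n\ge2$), $\tilde P'_{n,m}$ ($n\ge 3$), $\tilde S_{n,m}$, $\tilde T_{n,m}$, $\tilde S'_{n,m}$, $\tilde T'_{n,m}$ ($n\ge5$ odd), for some $m\ge2$. -/

import Mathlib

/-! ### Shellability of simplicial complexes and posets

A simplicial complex is given by its set of faces, the empty face included; the dimension of a face
`F` is `F.card - 1`. -/

namespace Shelling

/-- `F` is a facet (an inclusion-maximal face) of the complex `K`. -/
def IsFacet {ι : Type*} (K : Set (Finset ι)) (F : Finset ι) : Prop :=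
  Maximal (· ∈ K) F

/-- `K` is pure of dimension `c - 1`: it has a face, and all its facets have `c` elements. -/
def IsPureOfCard {ι : Type*} (K : Set (Finset ι)) (c : ℕ) : Prop :=
  K.Nonempty ∧ ∀ F, IsFacet K F → F.card = c

/-- The complex of all the faces of the simplex `F`. -/
def simplex {ι : Type*} (F : Finset ι) : Set (Finset ι) :=
  {σ | σ ⊆ F}

/-- `F 0, …, F (t - 1)` is a (nonpure) shelling of `K`: it lists every facet of `K` exactly once,
and every facet but the first meets the union of the preceding ones in a pure complex of
dimension one less than its own. -/
def IsShelling {ι : Type*} (K : Set (Finset ι)) {t : ℕ} (F : Fin t → Finset ι) : Prop :=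
  Function.Injective F ∧ Set.range F = {σ | IsFacet K σ} ∧
    ∀ k : Fin t, 0 < (k : ℕ) →
      IsPureOfCard ((⋃ i : Fin t, ⋃ _ : i < k, simplex (F i)) ∩ simplex (F k)) ((F k).card - 1)

/-- A simplicial complex is shellable if it has a shelling. -/
def IsShellable {ι : Type*} (K : Set (Finset ι)) : Prop :=
  ∃ (t : ℕ) (F : Fin t → Finset ι), IsShelling K F

/-- The order complex of a poset: its faces are the finite chains. -/
def orderComplex (P : Type*) [PartialOrder P] : Set (Finset P) :=
  {σ | IsChain (· ≤ ·) (σ : Set P)}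

/-- A poset is shellable if its order complex is. -/
def IsShellablePoset (P : Type*) [PartialOrder P] : Prop :=
  IsShellable (orderComplex P)

end Shelling

/-! ### Graphs with multiple edges -/

namespace Graph

/-- The set of edges of `G` with endpoints `x` and `y`. -/
def edgesBetween {α β : Type*} (G : Graph α β) (x y : α) : Set β :=
  {e | G.IsLink e x y}

/-- An edge is multiple if another edge has the same endpoints. -/
def IsMultipleEdge {α β : Type*} (G : Graph α β) (e : β) : Prop :=
  ∃ f, f ≠ e ∧ ∃ x y, G.IsLink e x y ∧ G.IsLink f x y

/-- A bundle: the set of all the edges between two vertices, if there are at least two of them. -/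
def IsBundle {α β : Type*} (G : Graph α β) (B : Set β) : Prop :=
  B.Nontrivial ∧ ∃ x y, B = G.edgesBetween x y

/-- A graph is connected if it has a vertex and any two of its vertices are joined by a walk. -/
def IsConnectedGraph {α β : Type*} (G : Graph α β) : Prop :=
  G.vertexSet.Nonempty ∧
    ∀ x ∈ G.vertexSet, ∀ y ∈ G.vertexSet, Relation.ReflTransGen G.Adj x y

/-- `K` is a connected component of `G`. -/
def IsComponentOf {α β : Type*} (K G : Graph α β) : Prop :=
  K.IsClosedSubgraph G ∧ K.IsConnectedGraph

/-- `I` is a semi-induced subgraph of `H`: it has at least one edge between any two of its vertices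
that are adjacent in `H`. -/
def IsSemiInduced {α β : Type*} (I H : Graph α β) : Prop :=
  I ≤ H ∧ ∀ x ∈ I.vertexSet, ∀ y ∈ I.vertexSet, H.Adj x y → I.Adj x y

/-- `H` is a partial underlying graph of `G`: some bundles of `G` are replaced with simple edges.
The simple edge that replaces a bundle is realized by an edge of that bundle. -/
def IsPartialUnderlying {α β : Type*} (H G : Graph α β) : Prop :=
  H.IsSpanningSubgraph G ∧ ∀ x y, H.edgesBetween x y = G.edgesBetween x y ∨
    (G.IsBundle (G.edgesBetween x y) ∧ ∃ e, H.edgesBetween x y = {e})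

/-- `H` is a partial underlying induced graph of `G`. -/
def IsPIGraph {α β : Type*} (H G : Graph α β) : Prop :=
  ∃ K : Graph α β, K.IsPartialUnderlying G ∧ H.IsInducedSubgraph K

/-- The set `𝒞_H` of all the vertices and all the multiple edges of `H`. -/
def labels {α β : Type*} (H : Graph α β) : Set (α ⊕ β) :=
  Sum.inl '' H.vertexSet ∪ Sum.inr '' {e | H.IsMultipleEdge e}

/-- `A` is admissible to the connected graph `H`. -/
def IsAdmissibleConnected {α β : Type*} (H : Graph α β) (A : Set (α ⊕ β)) : Prop :=
  A ⊆ H.labels ∧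
  Even (A ∩ Sum.inl '' H.vertexSet).ncard ∧
  (∀ x ∈ H.vertexSet, (∀ e, H.Inc e x → ¬ H.IsMultipleEdge e) → Sum.inl x ∈ A) ∧
  ∀ B : Set β, H.IsBundle B →
    (A ∩ Sum.inr '' B).Nonempty ∧ Even (A ∩ Sum.inr '' B).ncard

/-- `A` is admissible to the graph `H`: its part in each component of `H` is admissible to that
component. -/
def IsAdmissible {α β : Type*} (H : Graph α β) (A : Set (α ⊕ β)) : Prop :=
  A ⊆ H.labels ∧ ∀ K : Graph α β, K.IsComponentOf H → K.IsAdmissibleConnected (K.labels ∩ A)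

/-- `I` is `A`-even: each of its components has an even number of vertices and edges in `A`. -/
def IsEvenFor {α β : Type*} (I : Graph α β) (A : Set (α ⊕ β)) : Prop :=
  ∀ K : Graph α β, K.IsComponentOf I →
    Even ((Sum.inl '' K.vertexSet ∪ Sum.inr '' K.edgeSet) ∩ A).ncard

/-- The poset of all the `A`-even semi-induced subgraphs of `H`, ordered by subgraph containment. -/
abbrev EvenPoset {α β : Type*} (H : Graph α β) (A : Set (α ⊕ β)) : Type _ :=
  {I : Graph α β // I.IsSemiInduced H ∧ I.IsEvenFor A}

/-- The family `𝒢*` of graphs `G`: for every PI-graph `H` of `G` and every `A` admissible to `H`,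
the poset of `A`-even semi-induced subgraphs of `H` is shellable. -/
def InGStar {α β : Type*} (G : Graph α β) : Prop :=
  ∀ H : Graph α β, H.IsPIGraph G → ∀ A : Set (α ⊕ β), H.IsAdmissible A →
    Shelling.IsShellablePoset (EvenPoset H A)

/-- Isomorphism of graphs. -/
def Isomorphic {α β α' β' : Type*} (G : Graph α β) (G' : Graph α' β') : Prop :=
  ∃ (f : G.vertexSet ≃ G'.vertexSet) (g : G.edgeSet ≃ G'.edgeSet),
    ∀ (e : G.edgeSet) (x y : G.vertexSet), G.IsLink e x y ↔ G'.IsLink (g e) (f x) (f y)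

/-! ### The six families -/

/-- The graph with vertices `0, …, n - 1`, with `m` edges between `0` and `1`, and one further edge
for each pair of vertices in `S`. -/
def withBundle (n m : ℕ) (S : Set (Sym2 ℕ)) : Graph ℕ (ℕ ⊕ Sym2 ℕ) where
  vertexSet := {v | v < n}
  IsLink e x y := x < n ∧ y < n ∧
    ((∃ i < m, e = Sum.inl i ∧ s(x, y) = s(0, 1)) ∨ (s(x, y) ∈ S ∧ e = Sum.inr s(x, y)))
  isLink_symm := by
    intro e _
    refine ⟨fun x y h => ?_⟩
    rw [Sym2.eq_swap (a := y) (b := x)]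
    exact ⟨h.2.1, h.1, h.2.2⟩
  eq_or_eq_of_isLink_of_isLink := by
    rintro e x y v w ⟨-, -, h⟩ ⟨-, -, h'⟩
    have key : s(x, y) = s(v, w) := by
      rcases h with ⟨i, -, rfl, h⟩ | ⟨-, rfl⟩ <;> rcases h' with ⟨j, -, hj, h'⟩ | ⟨-, h'⟩
      · rw [h, h']
      · cases h'
      · cases hj
      · exact Sum.inr.inj h'
    rcases Sym2.eq_iff.1 key with h | h
    · exact Or.inl h.1
    · exact Or.inr h.1
  left_mem_of_isLink := fun _ _ _ h => h.1

/-- The simple edges of the path `1, 2, …, k`. -/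
def pathEdges (k : ℕ) : Set (Sym2 ℕ) :=
  {p | ∃ i, 1 ≤ i ∧ i + 1 ≤ k ∧ p = s(i, i + 1)}

/-- A path with `n` vertices whose first edge is replaced with a bundle of size `m`. -/
def tildeP (n m : ℕ) : Graph ℕ (ℕ ⊕ Sym2 ℕ) :=
  withBundle n m (pathEdges (n - 1))

/-- The path on `0, …, n - 2` whose first edge is replaced with a bundle of size `m`, with one more
vertex `n - 1` adjacent to the last but one vertex `n - 3` of the path. -/
def tildeS (n m : ℕ) : Graph ℕ (ℕ ⊕ Sym2 ℕ) :=
  withBundle n m (pathEdges (n - 2) ∪ {s(n - 3, n - 1)})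

/-- The graph `tildeS n m` with an edge added between `n - 2` and `n - 1`. -/
def tildeT (n m : ℕ) : Graph ℕ (ℕ ⊕ Sym2 ℕ) :=
  withBundle n m (pathEdges (n - 2) ∪ {s(n - 3, n - 1), s(n - 2, n - 1)})

/-- The graph `tildeP n m` with an edge added between `0` and `2`. -/
def tildeP' (n m : ℕ) : Graph ℕ (ℕ ⊕ Sym2 ℕ) :=
  withBundle n m (pathEdges (n - 1) ∪ {s(0, 2)})

/-- The graph `tildeS n m` with an edge added between `0` and `2`. -/
def tildeS' (n m : ℕ) : Graph ℕ (ℕ ⊕ Sym2 ℕ) :=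
  withBundle n m (pathEdges (n - 2) ∪ {s(n - 3, n - 1)} ∪ {s(0, 2)})

/-- The graph `tildeT n m` with an edge added between `0` and `2`. -/
def tildeT' (n m : ℕ) : Graph ℕ (ℕ ⊕ Sym2 ℕ) :=
  withBundle n m (pathEdges (n - 2) ∪ {s(n - 3, n - 1), s(n - 2, n - 1)} ∪ {s(0, 2)})

end Graph

/-! A shellable complex, pure or not, has shellable links, and a shellable complex has at most one
connected component of positive dimension. Hence a finite poset is not shellable once some open
interval splits into two mutually incomparable parts that both contain a two-element chain.
`not_isShellablePoset_of_separated` proves this directly from the definition of a shelling, and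
`not_isShellablePoset_of_slices` turns it into a parity test for even subgraphs.

Two configurations yield such intervals, in a suitable PI-graph and for a suitable admissible set.
In the first (`InGStar.false_of_branches`), a bundle `xy` lies outside a connected or empty set `I`
of even order, and each of two further vertices `q`, `r` forms with `I` and an end of the bundle a
connected set. With the labels `x, y, q, r` and two edges `a, b` of the bundle above `I`, an even
subgraph strictly between bottom and top cannot gain the second of `q, r` later than the first: `x,
y, a, b` would have to enter all together or not at all, and either choice breaks parity or reaches
an end of the interval. So the subgraphs containing `q` but not `r` are comparable to no others in
the interval. In the second (`InGStar.false_of_bundles`), there are two bundles, and two edges of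
the second one play the roles of `q` and `r`.

The rest is graph theory. The second configuration leaves only one bundle (`InGStar.bundle_unique`).
The first with `I = ∅` shows that at most one outside vertex is adjacent to the ends of the bundle.
From there a path `f 0, …, f k` is grown (`IsTrunk`), where `f 0, f 1` are the ends of the bundle
and only `f k` has neighbours outside. With no outside neighbour the graph is `tildeP` or `tildeP'`;
with one, the path is extended. With two, the segment `f 2, …, f k` has `k - 1` vertices, so odd `k`
gives the first configuration. For even `k`, adding one of the two neighbours to the segment makes
it even, and the first configuration excludes every further vertex: this is the fork of `tildeS`,
`tildeT` and their primed versions, on the odd number `k + 3` of vertices. The adjacency of `f 0`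
and `f 2` is never decided, whence the primes. -/

namespace Shelling

/-! ### Shellability and disconnected open intervals -/

/-- Over a finite vertex type, every face lies in a facet. -/
theorem exists_isFacet_superset {ι : Type*} [Finite ι] {K : Set (Finset ι)} {σ : Finset ι}
    (hσ : σ ∈ K) : ∃ F, σ ⊆ F ∧ IsFacet K F := by
  obtain ⟨F, h1, h2⟩ := (Set.toFinite K).exists_le_maximal hσ
  exact ⟨F, h1, h2⟩

/-- A chain through `I` and `J` that can be extended only inside the open interval `(I, J)`. -/
theorem exists_chain_extended_only_between {P : Type*} [PartialOrder P] [Finite P] {I J : P}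
    (hIJ : I < J) : ∃ C : Finset P, I ∈ C ∧ J ∈ C ∧ IsChain (· ≤ ·) (C : Set P) ∧
      (∀ z ∈ C, z ≤ I ∨ J ≤ z) ∧
      ∀ F : Finset P, IsChain (· ≤ ·) (F : Set P) → C ⊆ F → ∀ z ∈ F, z ∉ C → I < z ∧ z < J := by
  classical
  have h0 : ({I, J} : Finset P) ∈ orderComplex P := by
    simp only [orderComplex, Set.mem_ofPred_eq, Finset.coe_insert, Finset.coe_singleton]
    exact IsChain.pair hIJ.le
  obtain ⟨F, hF, hFf⟩ := exists_isFacet_superset h0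
  have hFc : IsChain (· ≤ ·) (F : Set P) := hFf.1
  have hI : I ∈ F := hF (by simp)
  have hJ : J ∈ F := hF (by simp)
  have key : ∀ (S : Set P) (z : P), IsChain (· ≤ ·) S → I ∈ S → J ∈ S → z ∈ S →
      ¬ (I < z ∧ z < J) → z ≤ I ∨ J ≤ z := by
    intro S z hS hI hJ hz hn
    rcases hS.total hz hI with h | h
    · exact Or.inl h
    · rcases hS.total hz hJ with h' | h'
      · by_contra hcon
        push Not at hcon
        exact hn ⟨lt_of_le_of_ne h (fun e => hcon.1 e.ge),
          lt_of_le_of_ne h' (fun e => hcon.2 e.ge)⟩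
      · exact Or.inr h'
  -- `C` is a maximal chain through `I` and `J` with its part in the open interval deleted.
  refine ⟨F.filter fun z => ¬ (I < z ∧ z < J), by simp [hI], by simp [hJ], ?_, ?_, ?_⟩
  · exact hFc.mono (by intro z hz; simp at hz; exact hz.1)
  · intro z hz
    rw [Finset.mem_filter] at hz
    exact key _ z hFc hI hJ hz.1 hz.2
  · intro F' hF' hCF' z hz hzC
    by_contra hn
    refine hzC (Finset.mem_filter.2 ⟨?_, hn⟩)
    have hz' := key _ z hF' (hCF' (by simp [hI])) (hCF' (by simp [hJ])) hz hn
    -- An element outside the interval is comparable to the elements of `F` inside it through `I` or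
    -- `J`, and to the other elements of `F` because these lie in `F'`. Maximality of `F` then
    -- forces it into `F`.
    have hmem : insert z F ∈ orderComplex P := by
      simp only [orderComplex, Set.mem_ofPred_eq, Finset.coe_insert]
      refine hFc.insert fun b hb _ => ?_
      by_cases hbI : I < b ∧ b < J
      · rcases hz' with h | h
        · exact Or.inl (h.trans hbI.1.le)
        · exact Or.inr (hbI.2.le.trans h)
      · exact hF'.total hz (hCF' (Finset.mem_filter.2 ⟨hb, hbI⟩))
    exact hFf.2 hmem (Finset.subset_insert _ _) (Finset.mem_insert_self _ _)

/-- A finite poset is not shellable if one of its open intervals has two connected components that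
both contain a chain with two elements. -/
theorem not_isShellablePoset_of_separated {P : Type*} [PartialOrder P] [Finite P] {I J : P}
    (Q : P → Prop) (hQ : ∀ X Y, I < X → X < Y → Y < J → (Q X ↔ Q Y))
    {X₁ Y₁ X₂ Y₂ : P} (h₁ : I < X₁) (h₁' : X₁ < Y₁) (h₁'' : Y₁ < J)
    (h₂ : I < X₂) (h₂' : X₂ < Y₂) (h₂'' : Y₂ < J) (hQ₁ : Q X₁) (hQ₂ : ¬ Q X₂) :
    ¬ IsShellablePoset P := by
  classical
  rintro ⟨t, F, hinj, hrange, hsh⟩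
  obtain ⟨C, hIC, hJC, hCc, hCout, hCin⟩ :=
    exists_chain_extended_only_between (h₁.trans (h₁'.trans h₁''))
  have hfacet : ∀ i, IsFacet (orderComplex P) (F i) := fun i => by
    have : F i ∈ Set.range F := ⟨i, rfl⟩
    rwa [hrange] at this
  -- `big R i`: the facet `F i` extends `C` by at least two elements, all of which satisfy `R`
  let big : (P → Prop) → Fin t → Prop := fun R i =>
    C ⊆ F i ∧ C.card + 2 ≤ (F i).card ∧ ∃ z ∈ F i, z ∉ C ∧ R z
  -- Beyond `C`, a facet containing `C` is a chain in the open interval, so `Q` is constant there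
  -- and the facet has a type.
  have hcomp : ∀ i, C ⊆ F i → ∀ z ∈ F i, ∀ w ∈ F i, z ∉ C → w ∉ C → (Q z ↔ Q w) := by
    intro i hi z hz w hw hzC hwC
    have hch : IsChain (· ≤ ·) (F i : Set P) := (hfacet i).1
    have h1 := hCin _ hch hi z hz hzC
    have h2 := hCin _ hch hi w hw hwC
    rcases eq_or_ne z w with rfl | hne
    · rfl
    · rcases hch.total hz hw with h | h
      · exact hQ z w h1.1 (lt_of_le_of_ne h hne) h2.2
      · exact (hQ w z h2.1 (lt_of_le_of_ne h hne.symm) h1.2).symm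
  have hex : ∀ (R : P → Prop) (X Y : P), I < X → X < Y → Y < J → R X → ∃ i, big R i := by
    intro R X Y hX hXY hY hR
    have hXC : X ∉ C := fun h => by
      rcases hCout X h with h | h
      · exact absurd hX h.not_gt
      · exact absurd (hXY.trans hY) h.not_gt
    have hYC : Y ∉ C := fun h => by
      rcases hCout Y h with h | h
      · exact absurd (hX.trans hXY) h.not_gt
      · exact absurd hY h.not_gt
    have hmem : insert X (insert Y C) ∈ orderComplex P := by
      simp only [orderComplex, Set.mem_ofPred_eq, Finset.coe_insert]
      refine (hCc.insert fun b hb _ => ?_).insert fun b hb _ => ?_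
      · rcases hCout b hb with h | h
        · exact Or.inr (h.trans (hX.trans hXY).le)
        · exact Or.inl (hY.le.trans h)
      · rcases hb with rfl | hb
        · exact Or.inl hXY.le
        · rcases hCout b hb with h | h
          · exact Or.inr (h.trans hX.le)
          · exact Or.inl ((hXY.trans hY).le.trans h)
    obtain ⟨F', hF', hF'f⟩ := exists_isFacet_superset hmem
    obtain ⟨i, rfl⟩ : F' ∈ Set.range F := by rw [hrange]; exact hF'f
    refine ⟨i, fun z hz => hF' (by simp [hz]), ?_, X, hF' (by simp), hXC, hR⟩
    have hc := Finset.card_le_card hF'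
    rw [Finset.card_insert_of_notMem (by simp [hXC, hXY.ne]),
      Finset.card_insert_of_notMem hYC] at hc
    omega
  -- the first big facet of either type, given an earlier big facet of the other type
  have main : ∀ R : P → Prop, (∀ z w, (Q z ↔ Q w) → (R z ↔ R w)) →
      ∀ k j : Fin t, big R k → (∀ i, i < k → ¬ big R i) → j < k → C ⊆ F j → False := by
    intro R hR k j hk hmin hjk hCj
    obtain ⟨hCk, hcard, z, hz, hzC, hRz⟩ := hk
    have hpure := (hsh k (by exact lt_of_le_of_lt (Nat.zero_le _) hjk)).2
    have hCmem : C ∈ (⋃ i : Fin t, ⋃ _ : i < k, simplex (F i)) ∩ simplex (F k) :=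
      ⟨Set.mem_iUnion₂.2 ⟨j, hjk, hCj⟩, hCk⟩
    -- Purity makes the facet `τ` of the intersection only one element smaller than `F k`, hence
    -- strictly larger than `C`. The earlier facet `F i` containing `τ` thus has the same type as `F
    -- k`.
    obtain ⟨τ, hCτ, hτ⟩ := exists_isFacet_superset hCmem
    have hτc := hpure τ hτ
    obtain ⟨i, hik, hτi⟩ := Set.mem_iUnion₂.1 hτ.1.1
    have hτk : τ ⊆ F k := hτ.1.2
    have hτi : τ ⊆ F i := hτi
    obtain ⟨w, hw, hwC⟩ : ∃ w ∈ τ, w ∉ C := by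
      by_contra hcon
      push Not at hcon
      have := Finset.card_le_card (show τ ⊆ C from hcon)
      omega
    have hRw : R w := (hR _ _ (hcomp k hCk z hz w (hτk hw) hzC hwC)).1 hRz
    refine hmin i hik ⟨hCτ.trans hτi, ?_, w, hτi hw, hwC, hRw⟩
    -- If `F i` exceeded `C` by at most one element, it would equal `τ` and lie in the facet `F k`.
    by_contra hlt
    have hle := Finset.card_le_card hτi
    have heq : τ = F i := Finset.eq_of_subset_of_card_le hτi (by omega)
    have hsub : F i ⊆ F k := heq ▸ hτk
    have : F i = F k := Finset.Subset.antisymm hsub ((hfacet i).2 (hfacet k).1 hsub)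
    exact hik.ne (hinj this)
  have hmin : ∀ R : P → Prop, (∃ i, big R i) → ∃ i, big R i ∧ ∀ j, j < i → ¬ big R j := by
    rintro R ⟨i, hi⟩
    obtain ⟨m, hm1, hm2⟩ := (Set.toFinite {i | big R i}).exists_le_minimal hi
    exact ⟨m, hm2.1, fun j hj hb => (hm2.2 hb hj.le).not_gt hj⟩
  obtain ⟨k₁, hk₁, hk₁'⟩ := hmin Q (hex Q X₁ Y₁ h₁ h₁' h₁'' hQ₁)
  obtain ⟨k₂, hk₂, hk₂'⟩ := hmin (fun z => ¬ Q z) (hex _ X₂ Y₂ h₂ h₂' h₂'' hQ₂)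
  rcases lt_trichotomy k₁ k₂ with h | h | h
  · exact main _ (fun z w h => not_congr h) k₂ k₁ hk₂ hk₂' h hk₁.1
  · subst h
    obtain ⟨hC, -, z, hz, hzC, hz'⟩ := hk₁
    obtain ⟨-, -, w, hw, hwC, hw'⟩ := hk₂
    exact hw' ((hcomp _ hC z hz w hw hzC hwC).1 hz')
  · exact main Q (fun z w h => h) k₁ k₂ hk₁ hk₁' h hk₂.1

end Shelling

namespace Graph

/-! ### Connected vertex sets -/

/-- The set of all the vertices and edges of a graph. -/
def parts {α β : Type*} (X : Graph α β) : Set (α ⊕ β) :=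
  Sum.inl '' X.vertexSet ∪ Sum.inr '' X.edgeSet

@[simp] theorem inl_mem_parts {α β : Type*} {X : Graph α β} {x : α} :
    Sum.inl x ∈ X.parts ↔ x ∈ X.vertexSet := by simp [parts]

@[simp] theorem inr_mem_parts {α β : Type*} {X : Graph α β} {e : β} :
    Sum.inr e ∈ X.parts ↔ e ∈ X.edgeSet := by simp [parts]

theorem parts_mono {α β : Type*} {X Y : Graph α β} (h : X ≤ Y) : X.parts ⊆ Y.parts :=
  Set.union_subset_union (Set.image_mono h.vertexSet_mono) (Set.image_mono h.edgeSet_mono)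

/-- The vertices in `W` induce a connected (or empty) subgraph of `G`. -/
def ConnOn {α β : Type*} (G : Graph α β) (W : Set α) : Prop :=
  ∀ u ∈ W, ∀ v ∈ W, Relation.ReflTransGen (fun u v => G.Adj u v ∧ u ∈ W ∧ v ∈ W) u v

theorem connOn_empty {α β : Type*} (G : Graph α β) : G.ConnOn ∅ := by
  intro u hu
  exact hu.elim

theorem connOn_singleton {α β : Type*} (G : Graph α β) (x : α) : G.ConnOn {x} := by
  rintro u rfl v rfl
  exact .refl

theorem connOn_pair {α β : Type*} {G : Graph α β} {x y : α} (h : G.Adj x y) :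
    G.ConnOn {x, y} := by
  rintro u (rfl | rfl) v (rfl | rfl)
  · exact .refl
  · exact .single ⟨h, by simp, by simp⟩
  · exact .single ⟨h.symm, by simp, by simp⟩
  · exact .refl

theorem ConnOn.union {α β : Type*} {G : Graph α β} {W W' : Set α} (h : G.ConnOn W)
    (h' : G.ConnOn W') {z : α} (hz : z ∈ W) (hz' : z ∈ W') : G.ConnOn (W ∪ W') := by
  have h1 : ∀ u v, Relation.ReflTransGen (fun u v => G.Adj u v ∧ u ∈ W ∧ v ∈ W) u v →
      Relation.ReflTransGen (fun u v => G.Adj u v ∧ u ∈ W ∪ W' ∧ v ∈ W ∪ W') u v :=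
    fun u v h => h.lift id fun _ _ hab => ⟨hab.1, .inl hab.2.1, .inl hab.2.2⟩
  have h2 : ∀ u v, Relation.ReflTransGen (fun u v => G.Adj u v ∧ u ∈ W' ∧ v ∈ W') u v →
      Relation.ReflTransGen (fun u v => G.Adj u v ∧ u ∈ W ∪ W' ∧ v ∈ W ∪ W') u v :=
    fun u v h => h.lift id fun _ _ hab => ⟨hab.1, .inr hab.2.1, .inr hab.2.2⟩
  rintro u (hu | hu) v (hv | hv)
  · exact h1 _ _ (h u hu v hv)
  · exact (h1 _ _ (h u hu z hz)).trans (h2 _ _ (h' z hz' v hv))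
  · exact (h2 _ _ (h' u hu z hz')).trans (h1 _ _ (h z hz v hv))
  · exact h2 _ _ (h' u hu v hv)

theorem ConnOn.insert {α β : Type*} {G : Graph α β} {W : Set α} (h : G.ConnOn W) {w z : α}
    (hw : w ∈ W) (hz : G.Adj w z) : G.ConnOn (insert z W) := by
  have := h.union (connOn_pair hz) hw (by simp)
  convert! this using 1
  ext t
  simp only [Set.mem_insert_iff, Set.mem_union, Set.mem_singleton_iff]
  constructor
  · tauto
  · rintro (h | rfl | h) <;> tauto

/-! ### Components and even subgraphs -/

theorem IsComponentOf.eq_of_preconnected {α β : Type*} {K X : Graph α β}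
    (hX : ∀ u ∈ X.vertexSet, ∀ v ∈ X.vertexSet, Relation.ReflTransGen X.Adj u v)
    (hK : K.IsComponentOf X) : K = X := by
  obtain ⟨u, hu⟩ := hK.2.1
  refine hK.1.isInducedSubgraph.ext_of_vertexSet
    (Set.Subset.antisymm hK.1.vertexSet_mono fun v hv => ?_)
  have := hX u (hK.1.vertexSet_mono hu) v hv
  induction this with
  | refl => exact hu
  | tail h1 h2 ih => exact (hK.1.mem_iff_of_adj h2).1 (ih h2.left_mem)

theorem isEvenFor_of_preconnected {α β : Type*} {X : Graph α β} {A : Set (α ⊕ β)}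
    (hX : ∀ u ∈ X.vertexSet, ∀ v ∈ X.vertexSet, Relation.ReflTransGen X.Adj u v)
    (h : Even (X.parts ∩ A).ncard) : X.IsEvenFor A := by
  intro K hK
  rw [hK.eq_of_preconnected hX]
  exact h

theorem reachable_isComponentOf {α β : Type*} {X : Graph α β} {v : α} (hv : v ∈ X.vertexSet) :
    (X.induce {w | Relation.ReflTransGen X.Adj v w}).IsComponentOf X := by
  have hsub : {w | Relation.ReflTransGen X.Adj v w} ⊆ X.vertexSet := by
    intro w hw
    induction hw with
    | refl => exact hv
    | tail _ h _ => exact h.right_mem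
  refine ⟨IsClosedSubgraph.mk' (induce_le hsub) ?_, ⟨v, .refl⟩, ?_⟩
  · rintro e x ⟨y, hxy⟩ hx
    have hx' : Relation.ReflTransGen X.Adj v x := hx
    have : (X.induce {w | Relation.ReflTransGen X.Adj v w}).IsLink e x y :=
      ⟨hxy, hx, hx'.tail hxy.adj⟩
    exact this.edge_mem
  · have key : ∀ w, Relation.ReflTransGen X.Adj v w →
        Relation.ReflTransGen (X.induce {w | Relation.ReflTransGen X.Adj v w}).Adj v w := by
      intro w hw
      induction hw with
      | refl => exact .refl
      | tail h1 h2 ih =>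
        obtain ⟨e, he⟩ := h2
        exact ih.tail ⟨e, he, h1, h1.tail he.adj⟩
    intro x hx y hy
    exact (symm (key x hx)).trans (key y hy)

/-- The number of labels of a finite even subgraph is even. -/
theorem IsEvenFor.even_ncard {α β : Type*} {X : Graph α β} {A : Set (α ⊕ β)}
    (hfin : (X.parts ∩ A).Finite) (h : X.IsEvenFor A) : Even (X.parts ∩ A).ncard := by
  classical
  -- The labels are sorted by the component they lie in, represented by its vertex set; an edge goes
  -- with its ends. Each nonempty fibre is the set of labels of one component.
  let comp : α ⊕ β → Set α := Sum.elim (fun v => {w | Relation.ReflTransGen X.Adj v w})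
    (fun e => {w | ∃ x y, X.IsLink e x y ∧ Relation.ReflTransGen X.Adj x w})
  have hcongr : ∀ {u v}, Relation.ReflTransGen X.Adj u v →
      {w | Relation.ReflTransGen X.Adj u w} = {w | Relation.ReflTransGen X.Adj v w} := by
    intro u v huv
    ext w
    exact ⟨fun h => (symm huv).trans h, fun h => huv.trans h⟩
  have hedge : ∀ {e x y}, X.IsLink e x y →
      comp (Sum.inr e) = {w | Relation.ReflTransGen X.Adj x w} := by
    intro e x y he
    ext w
    constructor
    · rintro ⟨x', y', he', hw⟩
      rcases he.left_eq_or_eq he' with rfl | rfl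
      · exact hw
      · exact (Relation.ReflTransGen.single he'.symm.adj).trans hw
    · exact fun hw => ⟨x, y, he, hw⟩
  rw [Set.ncard_eq_toFinset_card _ hfin,
    Finset.card_eq_sum_card_fiberwise (f := comp) (t := hfin.toFinset.image comp)
      (fun z hz => Finset.mem_image_of_mem _ hz)]
  refine Finset.even_sum _ fun b hb => ?_
  obtain ⟨ℓ, hℓ, rfl⟩ := Finset.mem_image.1 hb
  obtain ⟨v, hv, hcv⟩ : ∃ v ∈ X.vertexSet, comp ℓ = {w | Relation.ReflTransGen X.Adj v w} := by
    have hℓ' := ((Set.Finite.mem_toFinset _).1 hℓ).1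
    rcases ℓ with v | e
    · exact ⟨v, by simpa using hℓ', rfl⟩
    · obtain ⟨x, y, hxy⟩ := exists_isLink_of_mem_edgeSet (inr_mem_parts.1 hℓ')
      exact ⟨x, hxy.left_mem, hedge hxy⟩
  have hK := reachable_isComponentOf hv
  have hev := h _ hK
  rw [← Set.ncard_coe_finset]
  convert! hev using 2
  ext z
  simp only [Finset.coe_filter, Set.Finite.mem_toFinset, Set.mem_ofPred_eq]
  change _ ↔ z ∈ parts _ ∩ A
  rw [hcv]
  constructor
  · rintro ⟨⟨hz, hzA⟩, hzc⟩
    refine ⟨?_, hzA⟩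
    rcases z with z | e
    · rw [inl_mem_parts]
      change z ∈ {w | Relation.ReflTransGen X.Adj v w}
      rw [← hzc]
      exact Relation.ReflTransGen.refl
    · rw [inr_mem_parts]
      obtain ⟨x, y, hxy⟩ := exists_isLink_of_mem_edgeSet (inr_mem_parts.1 hz)
      rw [hedge hxy] at hzc
      have hx : x ∈ {w | Relation.ReflTransGen X.Adj v w} := by
        rw [← hzc]
        exact Relation.ReflTransGen.refl
      exact hK.1.closed hxy.inc_left hx
  · rintro ⟨hz, hzA⟩
    refine ⟨⟨parts_mono hK.1.le hz, hzA⟩, ?_⟩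
    rcases z with z | e
    · exact (hcongr (inl_mem_parts.1 hz)).symm
    · obtain ⟨x, y, hxy⟩ := exists_isLink_of_mem_edgeSet (inr_mem_parts.1 hz)
      rw [hedge hxy.1]
      exact (hcongr hxy.2.1).symm

/-- The number of labels of `X` exceeds that of its subgraph `I` by the number of those additional
labels that `X` contains. -/
theorem ncard_parts_inter {α β : Type*} [DecidableEq (α ⊕ β)] {I X : Graph α β} {A : Set (α ⊕ β)}
    (hIX : I ≤ X) (hfin : I.parts.Finite) (D : Finset (α ⊕ β)) (hDA : ∀ d ∈ D, d ∈ A)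
    (hDI : ∀ d ∈ D, d ∉ I.parts) (hX : ∀ z ∈ X.parts, z ∈ A → z ∈ I.parts ∨ z ∈ D)
    [DecidablePred (· ∈ X.parts)] :
    (X.parts ∩ A).ncard = (I.parts ∩ A).ncard + ∑ d ∈ D, if d ∈ X.parts then 1 else 0 := by
  have heq : X.parts ∩ A = (I.parts ∩ A) ∪ (D.filter (· ∈ X.parts) : Finset (α ⊕ β)) := by
    ext z
    simp only [Set.mem_inter_iff, Set.mem_union, Finset.coe_filter, Set.mem_ofPred_eq]
    constructor
    · rintro ⟨h1, h2⟩
      rcases hX z h1 h2 with h | h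
      · exact Or.inl ⟨h, h2⟩
      · exact Or.inr ⟨h, h1⟩
    · rintro (⟨h1, h2⟩ | ⟨h1, h2⟩)
      · exact ⟨parts_mono hIX h1, h2⟩
      · exact ⟨h2, hDA z h1⟩
  rw [heq, Set.ncard_union_eq _ (hfin.inter_of_left A) (Finset.finite_toSet _),
    Set.ncard_coe_finset, Finset.card_filter]
  rw [Set.disjoint_left]
  rintro z ⟨h1, -⟩ h2
  exact hDI z (Finset.mem_filter.1 h2).1 h1

/-! ### Semi-induced subgraphs -/

/-- The subgraph of `H` with vertex set `W` and all the edges of `H` on `W` but those in `D`. -/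
def slice {α β : Type*} (H : Graph α β) (W : Set α) (D : Set β) : Graph α β :=
  (H.induce W).restrict Dᶜ

@[simp] theorem vertexSet_slice {α β : Type*} (H : Graph α β) (W : Set α) (D : Set β) :
    (H.slice W D).vertexSet = W := rfl

theorem slice_isLink {α β : Type*} {H : Graph α β} {W : Set α} {D : Set β} {e : β} {x y : α} :
    (H.slice W D).IsLink e x y ↔ H.IsLink e x y ∧ x ∈ W ∧ y ∈ W ∧ e ∉ D := by
  simp only [slice, restrict, Graph.induce, Set.mem_compl_iff]
  tauto

theorem mem_edgeSet_slice {α β : Type*} {H : Graph α β} {W : Set α} {D : Set β} {e : β} {x y : α}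
    (he : H.IsLink e x y) : e ∈ (H.slice W D).edgeSet ↔ x ∈ W ∧ y ∈ W ∧ e ∉ D := by
  constructor
  · intro h
    obtain ⟨u, v, huv⟩ := exists_isLink_of_mem_edgeSet h
    rw [slice_isLink] at huv
    rcases huv.1.eq_and_eq_or_eq_and_eq he with ⟨rfl, rfl⟩ | ⟨rfl, rfl⟩ <;> tauto
  · exact fun h => (slice_isLink.2 ⟨he, h⟩).edge_mem

theorem slice_mono {α β : Type*} (H : Graph α β) {W W' : Set α} {D D' : Set β} (hW : W ⊆ W')
    (hD : D' ⊆ D) : H.slice W D ≤ H.slice W' D' :=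
  ⟨hW, fun _ _ _ h => by
    rw [slice_isLink] at h ⊢
    exact ⟨h.1, hW h.2.1, hW h.2.2.1, fun h' => h.2.2.2 (hD h')⟩⟩

theorem slice_le {α β : Type*} (H : Graph α β) {W : Set α} (D : Set β) (hW : W ⊆ H.vertexSet) :
    H.slice W D ≤ H :=
  ⟨hW, fun _ _ _ h => (slice_isLink.1 h).1⟩

theorem slice_isSemiInduced {α β : Type*} {H : Graph α β} {W : Set α} {D : Set β}
    (hW : W ⊆ H.vertexSet) (hD : ∀ e ∈ D, ∀ x ∈ W, ∀ y ∈ W, H.IsLink e x y →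
      ∃ f, f ∉ D ∧ H.IsLink f x y) : (H.slice W D).IsSemiInduced H := by
  refine ⟨slice_le H D hW, ?_⟩
  rintro x hx y hy ⟨e, he⟩
  by_cases heD : e ∈ D
  · obtain ⟨f, hf, hfl⟩ := hD e heD x hx y hy he
    exact ⟨f, slice_isLink.2 ⟨hfl, hx, hy, hf⟩⟩
  · exact ⟨e, slice_isLink.2 ⟨he, hx, hy, heD⟩⟩

/-- A semi-induced subgraph keeps an edge for each adjacent pair of its vertices, so its
connectedness depends on its vertex set alone. -/
theorem IsSemiInduced.preconnected {α β : Type*} {X H : Graph α β} (hX : X.IsSemiInduced H)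
    (h : H.ConnOn X.vertexSet) :
    ∀ u ∈ X.vertexSet, ∀ v ∈ X.vertexSet, Relation.ReflTransGen X.Adj u v := fun u hu v hv =>
  (h u hu v hv).lift id fun _ _ hab => hX.2 _ hab.2.1 _ hab.2.2 hab.1

/-- The simple edges of `H` between vertices of `X` are forced, so only vertices and multiple edges
need comparing. This is what turns strict inclusions at the ends of an interval into inequalities
between indicators. -/
theorem IsSemiInduced.eq_of_le {α β : Type*} {X Y H : Graph α β} (hX : X.IsSemiInduced H)
    (hYH : Y ≤ H) (hXY : X ≤ Y) (hV : Y.vertexSet ⊆ X.vertexSet)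
    (hE : ∀ e ∈ Y.edgeSet, H.IsMultipleEdge e → e ∈ X.edgeSet) : X = Y := by
  refine hXY.compatible.ext (hXY.vertexSet_mono.antisymm hV) (hXY.edgeSet_mono.antisymm ?_)
  intro e he
  by_cases hm : H.IsMultipleEdge e
  · exact hE e he hm
  obtain ⟨x, y, hxy⟩ := exists_isLink_of_mem_edgeSet he
  obtain ⟨f, hf⟩ := hX.2 x (hV hxy.left_mem) y (hV hxy.right_mem) (hxy.mono hYH).adj
  by_cases hfe : f = e
  · exact hfe ▸ hf.edge_mem
  · exact (hm ⟨f, hfe, x, y, hxy.mono hYH, hf.mono hX.1⟩).elim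

theorem finite_evenPoset {α β : Type*} {H : Graph α β} (hV : H.vertexSet.Finite)
    (hE : H.edgeSet.Finite) (A : Set (α ⊕ β)) : Finite (EvenPoset H A) := by
  have := hV.finite_subsets.to_subtype
  have := hE.finite_subsets.to_subtype
  refine Finite.of_injective (β := {s | s ⊆ H.vertexSet} × {s | s ⊆ H.edgeSet})
    (fun X => (⟨X.1.vertexSet, X.2.1.1.vertexSet_mono⟩, ⟨X.1.edgeSet, X.2.1.1.edgeSet_mono⟩)) ?_
  intro X Y h
  simp only [Prod.mk.injEq, Subtype.mk.injEq] at h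
  exact Subtype.ext ((Compatible.of_le_le X.2.1.1 Y.2.1.1).ext h.1 h.2)

theorem finite_parts {α β : Type*} {X H : Graph α β} (hX : X ≤ H) (hV : H.vertexSet.Finite)
    (hE : H.edgeSet.Finite) : X.parts.Finite :=
  ((hV.subset hX.vertexSet_mono).image _).union ((hE.subset hX.edgeSet_mono).image _)

theorem IsAdmissibleConnected.isAdmissible {α β : Type*} {H : Graph α β} {A : Set (α ⊕ β)}
    (hH : H.ConnOn H.vertexSet) (hA : H.IsAdmissibleConnected A) : H.IsAdmissible A := by
  refine ⟨hA.1, fun K hK => ?_⟩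
  have : K = H := hK.eq_of_preconnected fun u hu v hv => (hH u hu v hv).lift id fun _ _ h => h.1
  rw [this, Set.inter_eq_right.2 hA.1]
  exact hA

/-! ### Indicators and the parity criterion -/

open Classical in
/-- The indicator of the vertices and edges of a graph. -/
noncomputable def ind {α β : Type*} (X : Graph α β) (z : α ⊕ β) : ℕ :=
  if z ∈ X.parts then 1 else 0

theorem ind_eq_one {α β : Type*} {X : Graph α β} {z : α ⊕ β} : X.ind z = 1 ↔ z ∈ X.parts := by
  simp [ind]

theorem ind_eq_zero {α β : Type*} {X : Graph α β} {z : α ⊕ β} : X.ind z = 0 ↔ z ∉ X.parts := by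
  simp [ind]

theorem ind_le_one {α β : Type*} (X : Graph α β) (z : α ⊕ β) : X.ind z ≤ 1 := by
  unfold ind
  split_ifs <;> simp

theorem ind_mono {α β : Type*} {X Y : Graph α β} (h : X ≤ Y) (z : α ⊕ β) : X.ind z ≤ Y.ind z := by
  by_cases hz : z ∈ X.parts
  · rw [ind_eq_one.2 hz, ind_eq_one.2 (parts_mono h hz)]
  · rw [ind_eq_zero.2 hz]
    exact Nat.zero_le _

theorem ind_edge_le {α β : Type*} {X H : Graph α β} (h : X ≤ H) {e : β} {u v : α}
    (he : H.IsLink e u v) : X.ind (.inr e) ≤ X.ind (.inl u) ∧ X.ind (.inr e) ≤ X.ind (.inl v) := by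
  by_cases hz : e ∈ X.edgeSet
  · have hl := (h.isLink_iff hz).2 he
    rw [ind_eq_one.2 (inr_mem_parts.2 hz), ind_eq_one.2 (inl_mem_parts.2 hl.left_mem),
      ind_eq_one.2 (inl_mem_parts.2 hl.right_mem)]
    exact ⟨le_rfl, le_rfl⟩
  · rw [ind_eq_zero.2 (by simpa using hz)]
    exact ⟨Nat.zero_le _, Nat.zero_le _⟩

/-- A semi-induced subgraph containing the ends of a bundle, all of whose edges but two are
excluded, contains one of these two. -/
theorem ind_add_ind_le {α β : Type*} {X H : Graph α β} (hX : X.IsSemiInduced H) {u v : α}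
    {a b : β} (ha : H.IsLink a u v) (h : ∀ e ∈ X.edgeSet, H.IsLink e u v → e = a ∨ e = b) :
    X.ind (.inl u) + X.ind (.inl v) ≤ 1 + X.ind (.inr a) + X.ind (.inr b) := by
  have h1 := ind_le_one X (.inl u)
  have h2 := ind_le_one X (.inl v)
  by_contra hcon
  have hu : X.ind (.inl u) = 1 := by omega
  have hv : X.ind (.inl v) = 1 := by omega
  obtain ⟨e, he⟩ := hX.2 u (inl_mem_parts.1 (ind_eq_one.1 hu)) v
    (inl_mem_parts.1 (ind_eq_one.1 hv)) ha.adj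
  have he1 : X.ind (.inr e) = 1 := ind_eq_one.2 (inr_mem_parts.2 he.edge_mem)
  rcases h e he.edge_mem (he.mono hX.1) with rfl | rfl <;> omega

theorem lt_of_mem_parts {α β : Type*} {X Y : Graph α β} (h : X ≤ Y) {z : α ⊕ β} (hz : z ∈ Y.parts)
    (hz' : z ∉ X.parts) : X < Y :=
  lt_of_le_of_ne h fun he => hz' (he ▸ hz)

theorem ind_slice_inl {α β : Type*} {H : Graph α β} {W : Set α} {D : Set β} {z : α}
    [Decidable (z ∈ W)] : (H.slice W D).ind (.inl z) = if z ∈ W then 1 else 0 := by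
  simp [ind]

theorem ind_slice_inr {α β : Type*} {H : Graph α β} {W : Set α} {D : Set β} {e : β} {x y : α}
    (he : H.IsLink e x y) [Decidable (x ∈ W ∧ y ∈ W ∧ e ∉ D)] :
    (H.slice W D).ind (.inr e) = if x ∈ W ∧ y ∈ W ∧ e ∉ D then 1 else 0 := by
  simp [ind, mem_edgeSet_slice he]

/-- A criterion for nonshellability: the interval from `I` to `J` is separated by `Q`, where only
the parity of the number of labels outside `I` matters. -/
theorem not_isShellablePoset_of_slices {α β : Type*} {H : Graph α β} (hV : H.vertexSet.Finite)
    (hE : H.edgeSet.Finite) {A : Set (α ⊕ β)} {I J X₁ Y₁ X₂ Y₂ : Graph α β} (D : Finset (α ⊕ β))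
    (hDA : ∀ d ∈ D, d ∈ A) (hDI : ∀ d ∈ D, d ∉ I.parts)
    (hJD : ∀ z ∈ J.parts, z ∈ A → z ∈ I.parts ∨ z ∈ D)
    (hI : I.IsSemiInduced H) (hIc : H.ConnOn I.vertexSet) (hIe : Even (I.parts ∩ A).ncard)
    (hgood : ∀ Z ∈ [X₁, Y₁, X₂, Y₂, J], Z.IsSemiInduced H ∧ H.ConnOn Z.vertexSet ∧
      I ≤ Z ∧ Z ≤ J ∧ Even (∑ d ∈ D, Z.ind d))
    (h₁ : I < X₁) (h₁' : X₁ < Y₁) (h₁'' : Y₁ < J) (h₂ : I < X₂) (h₂' : X₂ < Y₂) (h₂'' : Y₂ < J)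
    (Q : Graph α β → Prop) (hQ₁ : Q X₁) (hQ₂ : ¬ Q X₂)
    (hQ : ∀ X Y : Graph α β, X.IsSemiInduced H → Y.IsSemiInduced H → I < X → X < Y → Y < J →
      Even (∑ d ∈ D, X.ind d) → Even (∑ d ∈ D, Y.ind d) → (Q X ↔ Q Y)) :
    ¬ Shelling.IsShellablePoset (EvenPoset H A) := by
  classical
  have := finite_evenPoset hV hE A
  have hfin := finite_parts hI.1 hV hE
  -- All labels of `J` outside `I` are in `D`, so between `I` and `J` the labels are counted by
  -- those of `I`, an even number, and the indicators on `D`.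
  have hcount : ∀ Z : Graph α β, I ≤ Z → Z ≤ J →
      (Z.parts ∩ A).ncard = (I.parts ∩ A).ncard + ∑ d ∈ D, Z.ind d := by
    intro Z hIZ hZJ
    rw [ncard_parts_inter hIZ hfin D hDA hDI fun z hz hzA => hJD z (parts_mono hZJ hz) hzA]
    congr 1
  -- The five named graphs are connected, so an even total is enough for evenness.
  have hmem : ∀ Z ∈ [X₁, Y₁, X₂, Y₂, J], Z.IsSemiInduced H ∧ Z.IsEvenFor A := by
    intro Z hZ
    obtain ⟨h1, h2, h3, h4, h5⟩ := hgood Z hZ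
    refine ⟨h1, isEvenFor_of_preconnected (h1.preconnected h2) ?_⟩
    rw [hcount Z h3 h4]
    exact hIe.add h5
  refine Shelling.not_isShellablePoset_of_separated
    (I := (⟨I, hI, isEvenFor_of_preconnected (hI.preconnected hIc) hIe⟩ : EvenPoset H A))
    (J := ⟨J, hmem J (by simp)⟩) (fun X => Q X.1) ?_
    (X₁ := ⟨X₁, hmem X₁ (by simp)⟩) (Y₁ := ⟨Y₁, hmem Y₁ (by simp)⟩)
    (X₂ := ⟨X₂, hmem X₂ (by simp)⟩) (Y₂ := ⟨Y₂, hmem Y₂ (by simp)⟩)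
    h₁ h₁' h₁'' h₂ h₂' h₂'' hQ₁ hQ₂
  rintro ⟨X, hX, hXe⟩ ⟨Y, hY, hYe⟩ hIX hXY hYJ
  have hIX : I < X := hIX
  have hXY : X < Y := hXY
  have hYJ : Y < J := hYJ
  -- An arbitrary member of the interval may be disconnected; for it only the necessary condition of
  -- an even total is used.
  have hsum : ∀ Z : Graph α β, Z.IsSemiInduced H → Z.IsEvenFor A → I ≤ Z → Z ≤ J →
      Even (∑ d ∈ D, Z.ind d) := by
    intro Z hZ hZe hIZ hZJ
    have h := hZe.even_ncard ((finite_parts hZ.1 hV hE).inter_of_left A)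
    rw [hcount Z hIZ hZJ] at h
    exact (Nat.even_add.1 h).1 hIe
  exact hQ X Y hX hY hIX hXY hYJ (hsum X hX hXe hIX.le (hXY.trans hYJ).le)
    (hsum Y hY hYe (hIX.trans hXY).le hYJ.le)

/-! ### First obstruction: one bundle and two branches -/

/-- The indicators of the two ends of a bundle and of two of its edges, if their sum is even. -/
theorem zero_or_one_of_even {p₁ p₂ p₃ p₄ : ℕ} (u1 : p₁ ≤ 1) (u2 : p₂ ≤ 1) (u3 : p₃ ≤ p₁)
    (u3' : p₃ ≤ p₂) (u4 : p₄ ≤ p₁) (u4' : p₄ ≤ p₂) (h : p₁ + p₂ ≤ 1 + p₃ + p₄)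
    (he : Even (p₁ + p₂ + p₃ + p₄)) :
    (p₁ = 0 ∧ p₂ = 0 ∧ p₃ = 0 ∧ p₄ = 0) ∨ (p₁ = 1 ∧ p₂ = 1 ∧ p₃ = 1 ∧ p₄ = 1) := by
  rw [Nat.even_iff] at he
  interval_cases p₁ <;> interval_cases p₂ <;> interval_cases p₃ <;> interval_cases p₄ <;> simp_all
-- The variables are the indicators of `x, y, q, r, a, b` in `X` and in `Y`. If membership of `q`
-- without `r` changed between `X` and `Y`, parity and `zero_or_one_of_even` would make `x, y, a, b`
-- all absent or all present in one of the two graphs. One alternative makes the other graph odd,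
-- and the other alternative reaches an end of the interval.
theorem branch_separation {x₁ x₂ x₃ x₄ x₅ x₆ y₁ y₂ y₃ y₄ y₅ y₆ : ℕ}
    (m1 : x₁ ≤ y₁) (m2 : x₂ ≤ y₂) (m3 : x₃ ≤ y₃) (m4 : x₄ ≤ y₄) (m5 : x₅ ≤ y₅) (m6 : x₆ ≤ y₆)
    (u1 : y₁ ≤ 1) (u2 : y₂ ≤ 1) (u3 : y₃ ≤ 1) (u4 : y₄ ≤ 1)
    (f1 : x₅ ≤ x₁) (f2 : x₅ ≤ x₂) (f3 : x₆ ≤ x₁) (f4 : x₆ ≤ x₂) (f5 : x₁ + x₂ ≤ 1 + x₅ + x₆)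
    (f6 : 1 ≤ x₁ + x₂ + x₃ + x₄)
    (g1 : y₅ ≤ y₁) (g2 : y₅ ≤ y₂) (g3 : y₆ ≤ y₁) (g4 : y₆ ≤ y₂) (g5 : y₁ + y₂ ≤ 1 + y₅ + y₆)
    (g7 : y₁ + y₂ + y₃ + y₄ + y₅ + y₆ ≤ 5)
    (hX : Even (x₁ + x₂ + x₃ + x₄ + x₅ + x₆)) (hY : Even (y₁ + y₂ + y₃ + y₄ + y₅ + y₆)) :
    (x₃ = 1 ∧ x₄ = 0) ↔ (y₃ = 1 ∧ y₄ = 0) := by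
  have hy3 : x₃ ≤ 1 := m3.trans u3
  have hy4 : x₄ ≤ 1 := m4.trans u4
  constructor
  · rintro ⟨h3, h4⟩
    have h3' : y₃ = 1 := le_antisymm u3 (h3 ▸ m3)
    refine ⟨h3', ?_⟩
    by_contra h4'
    have h4' : y₄ = 1 := by omega
    subst h3 h4 h3' h4'
    rcases zero_or_one_of_even u1 u2 g1 g2 g3 g4 g5 (by rw [Nat.even_iff] at *; omega) with
      ⟨rfl, rfl, rfl, rfl⟩ | ⟨rfl, rfl, rfl, rfl⟩
    · rw [Nat.even_iff] at hX
      omega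
    · omega
  · rintro ⟨h3, h4⟩
    have h4' : x₄ = 0 := Nat.le_zero.1 (h4 ▸ m4)
    refine ⟨?_, h4'⟩
    by_contra h3'
    have h3' : x₃ = 0 := by omega
    subst h3 h4 h3' h4'
    rcases zero_or_one_of_even (m1.trans u1) (m2.trans u2) f1 f2 f3 f4 f5
      (by rw [Nat.even_iff] at *; omega) with ⟨rfl, rfl, rfl, rfl⟩ | ⟨rfl, rfl, rfl, rfl⟩
    · omega
    · rw [Nat.even_iff] at hY
      omega

set_option maxHeartbeats 400000 in
/-- An obstruction: a single bundle between `x` and `y`, and two further vertices `q` and `r`, both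
attached to the union of a connected set `I` of even order and an end of the bundle. -/
theorem exists_not_isShellablePoset_of_branches {α β : Type*} {H : Graph α β}
    (hV : H.vertexSet.Finite) (hE : H.edgeSet.Finite) {I : Set α} {x y q r s t : α} {a b : β}
    (hVH : H.vertexSet = I ∪ {x, y, q, r}) (hxI : x ∉ I) (hyI : y ∉ I) (hqI : q ∉ I) (hrI : r ∉ I)
    (hxy : x ≠ y) (hxq : x ≠ q) (hxr : x ≠ r) (hyq : y ≠ q) (hyr : y ≠ r) (hqr : q ≠ r)
    (hab : a ≠ b) (ha : H.IsLink a x y) (hb : H.IsLink b x y)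
    (hmult : ∀ e, H.IsMultipleEdge e → H.IsLink e x y) (hIeven : Even I.ncard)
    (hs : s = x ∨ s = y) (ht : t = x ∨ t = y) (hI : H.ConnOn I) (hsq : H.ConnOn (I ∪ {s, q}))
    (htr : H.ConnOn (I ∪ {t, r})) :
    ∃ A, H.IsAdmissible A ∧ ¬ Shelling.IsShellablePoset (EvenPoset H A) := by
  classical
  have hIH : I ⊆ H.vertexSet := by rw [hVH]; exact Set.subset_union_left
  have hIfin : I.Finite := hV.subset hIH
  -- All vertices will be labelled, so their number `|I| + 4` has to be even.
  have hVcard : Even H.vertexSet.ncard := by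
    rw [hVH, Set.ncard_union_eq _ hIfin (Set.toFinite _)]
    · have : ({x, y, q, r} : Set α).ncard = 4 := by
        rw [Set.ncard_insert_of_notMem (by simp [hxy, hxq, hxr]),
          Set.ncard_insert_of_notMem (by simp [hyq, hyr]), Set.ncard_pair hqr]
      rw [this]
      exact hIeven.add ⟨2, rfl⟩
    · rw [Set.disjoint_right]
      rintro z (rfl | rfl | rfl | rfl) <;> assumption
  have hpair : H.ConnOn {x, y} := connOn_pair ha.adj
  have hxyq : H.ConnOn (I ∪ {x, y, q}) := by
    have := hsq.union hpair (z := s) (by simp) (by simpa using hs)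
    convert! this using 1
    ext z
    simp only [Set.mem_union, Set.mem_insert_iff, Set.mem_singleton_iff]
    rcases hs with rfl | rfl <;> tauto
  have hxyr : H.ConnOn (I ∪ {x, y, r}) := by
    have := htr.union hpair (z := t) (by simp) (by simpa using ht)
    convert! this using 1
    ext z
    simp only [Set.mem_union, Set.mem_insert_iff, Set.mem_singleton_iff]
    rcases ht with rfl | rfl <;> tauto
  have hall : H.ConnOn H.vertexSet := by
    have := hxyq.union hxyr (z := x) (by simp) (by simp)
    convert! this using 1
    rw [hVH]
    ext z
    simp only [Set.mem_union, Set.mem_insert_iff, Set.mem_singleton_iff]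
    tauto
  have hma : H.IsMultipleEdge a := ⟨b, hab.symm, x, y, ha, hb⟩
  have hmb : H.IsMultipleEdge b := ⟨a, hab, x, y, hb, ha⟩
  have habE : ∀ B : Set β, H.IsBundle B → a ∈ B ∧ b ∈ B := by
    rintro B ⟨⟨e, he, f, hf, hef⟩, u, v, rfl⟩
    have hl := hmult e ⟨f, hef.symm, u, v, he, hf⟩
    rcases hl.eq_and_eq_or_eq_and_eq he with ⟨rfl, rfl⟩ | ⟨rfl, rfl⟩
    · exact ⟨ha, hb⟩
    · exact ⟨ha.symm, hb.symm⟩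
  -- The admissible set consists of all the vertices and of two edges of the only bundle.
  refine ⟨Sum.inl '' H.vertexSet ∪ Sum.inr '' {a, b}, IsAdmissibleConnected.isAdmissible hall
    ⟨?_, ?_, ?_, ?_⟩, ?_⟩
  · refine Set.union_subset_union_right _ (Set.image_mono ?_)
    rintro e (rfl | rfl) <;> assumption
  · have : (Sum.inl '' H.vertexSet ∪ Sum.inr '' {a, b}) ∩ Sum.inl '' H.vertexSet =
      (Sum.inl '' H.vertexSet : Set (α ⊕ β)) := Set.inter_eq_right.2 Set.subset_union_left
    rw [this, Set.ncard_image_of_injective _ Sum.inl_injective]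
    exact hVcard
  · intro z hz _
    simp [hz]
  · intro B hB
    obtain ⟨haB, hbB⟩ := habE B hB
    have : (Sum.inl '' H.vertexSet ∪ Sum.inr '' {a, b}) ∩ Sum.inr '' B =
        (Sum.inr '' {a, b} : Set (α ⊕ β)) := by
      ext z
      rcases z with z | z
      · simp
      · simp only [Set.mem_inter_iff, Set.mem_union, Set.mem_image, reduceCtorEq, and_false,
          exists_false, Sum.inr.injEq, exists_eq_right, Set.mem_insert_iff, Set.mem_singleton_iff,
          false_or]
        constructor
        · exact fun h => h.1
        · rintro (rfl | rfl) <;> simp [*]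
    rw [this, Set.ncard_image_of_injective _ Sum.inr_injective, Set.ncard_pair hab]
    exact ⟨⟨_, a, by simp, rfl⟩, even_two⟩
  -- Deleting `D₀` reduces the bundle to `a` and `b`, deleting `D₁` to `a` alone.
  set D₀ : Set β := {e | H.IsLink e x y ∧ e ≠ a ∧ e ≠ b} with hD₀
  set D₁ : Set β := {e | H.IsLink e x y ∧ e ≠ a} with hD₁
  have hD₀₁ : D₀ ⊆ D₁ := fun e he => ⟨he.1, he.2.1⟩
  have haD₀ : a ∉ D₀ := fun h => h.2.1 rfl
  have hbD₀ : b ∉ D₀ := fun h => h.2.2 rfl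
  have haD₁ : a ∉ D₁ := fun h => h.2 rfl
  have hbD₁ : b ∈ D₁ := ⟨hb, hab.symm⟩
  have hsemi : ∀ W ⊆ H.vertexSet, ∀ D ⊆ D₁, (H.slice W D).IsSemiInduced H := by
    intro W hW D hD
    refine slice_isSemiInduced hW fun e he u _ v _ huv => ⟨a, fun h => haD₁ (hD h), ?_⟩
    rcases (hD he).1.eq_and_eq_or_eq_and_eq huv with ⟨rfl, rfl⟩ | ⟨rfl, rfl⟩
    · exact ha
    · exact ha.symm
  have hIedge : ∀ {D e}, H.IsLink e x y → e ∉ (H.slice I D).edgeSet := by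
    intro D e he h
    exact hxI ((mem_edgeSet_slice he).1 h).1
  have hsum : ∀ Z : Graph α β,
      ∑ d ∈ ({.inl x, .inl y, .inl q, .inl r, .inr a, .inr b} : Finset (α ⊕ β)), Z.ind d =
      Z.ind (.inl x) + Z.ind (.inl y) + Z.ind (.inl q) + Z.ind (.inl r) + Z.ind (.inr a) +
        Z.ind (.inr b) := by
    intro Z
    rw [Finset.sum_insert (by simp [hxy, hxq, hxr]), Finset.sum_insert (by simp [hyq, hyr]),
      Finset.sum_insert (by simp [hqr]), Finset.sum_insert (by simp),
      Finset.sum_insert (by simp [hab]), Finset.sum_singleton]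
    ring
  have hsub : ∀ W ⊆ ({x, y, q, r} : Set α), I ∪ W ⊆ H.vertexSet := fun W hW => by
    rw [hVH]
    exact Set.union_subset_union_right _ hW
  have hV1 : I ∪ {s, q} ⊆ H.vertexSet := hsub _ (by rcases hs with rfl | rfl <;> grind)
  have hV2 : I ∪ {t, r} ⊆ H.vertexSet := hsub _ (by rcases ht with rfl | rfl <;> grind)
  have hV3 : I ∪ {x, y, q} ⊆ H.vertexSet := hsub _ (by grind)
  have hV4 : I ∪ {x, y, r} ⊆ H.vertexSet := hsub _ (by grind)
  have h13 : I ∪ {s, q} ⊆ I ∪ {x, y, q} := by rcases hs with rfl | rfl <;> grind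
  have h24 : I ∪ {t, r} ⊆ I ∪ {x, y, r} := by rcases ht with rfl | rfl <;> grind
  -- The labels gained over `I` are `s, q` in `X₁` and `x, y, q, a` in `Y₁`; likewise with `t` and
  -- `r` in `X₂` and `Y₂`. The top gains all six.
  refine not_isShellablePoset_of_slices hV hE (I := H.slice I D₁) (J := H.slice H.vertexSet D₀)
    (X₁ := H.slice (I ∪ {s, q}) D₁) (Y₁ := H.slice (I ∪ {x, y, q}) D₁)
    (X₂ := H.slice (I ∪ {t, r}) D₁) (Y₂ := H.slice (I ∪ {x, y, r}) D₁)
    {.inl x, .inl y, .inl q, .inl r, .inr a, .inr b} ?_ ?_ ?_ (hsemi I hIH _ subset_rfl) hI ?_ ?_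
    ?_ ?_ ?_ ?_ ?_ ?_ (fun X => X.ind (.inl q) = 1 ∧ X.ind (.inl r) = 0) ?_ ?_ ?_
  · simp [hVH]
  · simp [hxI, hyI, hqI, hrI, hIedge ha, hIedge hb]
  · rintro (z | z) hz hzA
    · have : z ∈ H.vertexSet := hz.elim (by simp) (by simp)
      rw [hVH] at this
      rcases this with h | h
      · exact Or.inl (by simpa using h)
      · right
        simpa using h
    · right
      simpa using hzA
  · have : (H.slice I D₁).parts ∩ (Sum.inl '' H.vertexSet ∪ Sum.inr '' {a, b}) = Sum.inl '' I := by
      ext (z | z)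
      · simp only [Set.mem_inter_iff, inl_mem_parts, vertexSet_slice]
        simpa using fun h => hIH h
      · simp only [Set.mem_inter_iff, inr_mem_parts]
        simp only [Set.mem_union, Set.mem_image, reduceCtorEq, and_false, exists_false,
          Sum.inr.injEq, exists_eq_right, false_or, iff_false, not_and]
        rintro h (rfl | rfl)
        · exact hIedge ha h
        · exact hIedge hb h
    rw [this, Set.ncard_image_of_injective _ Sum.inl_injective]
    exact hIeven
  · intro Z hZ
    simp only [List.mem_cons, List.not_mem_nil, or_false] at hZ
    rw [hsum]
    rcases hZ with rfl | rfl | rfl | rfl | rfl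
    · refine ⟨hsemi _ hV1 _ subset_rfl, hsq, slice_mono H Set.subset_union_left subset_rfl,
        slice_mono H hV1 hD₀₁, ?_⟩
      rw [ind_slice_inr ha, ind_slice_inr hb]
      simp only [ind_slice_inl]
      rcases hs with rfl | rfl <;> simp [hxI, hyI, hqI, hrI, hxy, hxy.symm, hxq, hxq.symm, hxr.symm,
        hyq, hyq.symm, hyr.symm, hqr.symm, haD₁, hbD₁]
    · refine ⟨hsemi _ hV3 _ subset_rfl, hxyq, slice_mono H Set.subset_union_left subset_rfl,
        slice_mono H hV3 hD₀₁, ?_⟩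
      rw [ind_slice_inr ha, ind_slice_inr hb]
      simp only [ind_slice_inl]
      simp [hxI, hyI, hqI, hrI, hxy, hxy.symm, hxq, hxq.symm, hxr.symm,
        hyq, hyq.symm, hyr.symm, hqr.symm, haD₁, hbD₁]
      decide
    · refine ⟨hsemi _ hV2 _ subset_rfl, htr, slice_mono H Set.subset_union_left subset_rfl,
        slice_mono H hV2 hD₀₁, ?_⟩
      rw [ind_slice_inr ha, ind_slice_inr hb]
      simp only [ind_slice_inl]
      rcases ht with rfl | rfl <;> simp [hxI, hyI, hqI, hrI, hxy, hxy.symm, hxq.symm, hxr, hxr.symm,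
        hyq.symm, hyr, hyr.symm, hqr, haD₁, hbD₁]
    · refine ⟨hsemi _ hV4 _ subset_rfl, hxyr, slice_mono H Set.subset_union_left subset_rfl,
        slice_mono H hV4 hD₀₁, ?_⟩
      rw [ind_slice_inr ha, ind_slice_inr hb]
      simp only [ind_slice_inl]
      simp [hxI, hyI, hqI, hrI, hxy, hxy.symm, hxq.symm, hxr, hxr.symm,
        hyq.symm, hyr, hyr.symm, hqr, haD₁, hbD₁]
      decide
    · refine ⟨hsemi _ subset_rfl _ hD₀₁, hall, slice_mono H hIH hD₀₁, le_rfl, ?_⟩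
      rw [ind_slice_inr ha, ind_slice_inr hb]
      simp only [ind_slice_inl]
      rw [if_pos, if_pos, if_pos, if_pos, if_pos, if_pos]
      · exact ⟨3, rfl⟩
      all_goals simp [hVH, haD₀, hbD₀]
  · exact lt_of_mem_parts (slice_mono H Set.subset_union_left subset_rfl) (z := .inl q)
      (by simp) (by simp [hqI])
  · rcases hs with rfl | rfl
    · exact lt_of_mem_parts (slice_mono H h13 subset_rfl) (z := .inl y)
        (by simp) (by simp [hyI, hxy.symm, hyq])
    · exact lt_of_mem_parts (slice_mono H h13 subset_rfl) (z := .inl x)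
        (by simp) (by simp [hxI, hxy, hxq])
  · exact lt_of_mem_parts (slice_mono H hV3 hD₀₁) (z := .inl r)
      (by simp [hVH]) (by simp [hrI, hxr.symm, hyr.symm, hqr.symm])
  · exact lt_of_mem_parts (slice_mono H Set.subset_union_left subset_rfl) (z := .inl r)
      (by simp) (by simp [hrI])
  · rcases ht with rfl | rfl
    · exact lt_of_mem_parts (slice_mono H h24 subset_rfl) (z := .inl y)
        (by simp) (by simp [hyI, hxy.symm, hyr])
    · exact lt_of_mem_parts (slice_mono H h24 subset_rfl) (z := .inl x)
        (by simp) (by simp [hxI, hxy, hxr])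
  · exact lt_of_mem_parts (slice_mono H hV4 hD₀₁) (z := .inl q)
      (by simp [hVH]) (by simp [hqI, hxq.symm, hyq.symm, hqr])
  · have hrs : r ≠ s := by rcases hs with rfl | rfl <;> [exact hxr.symm; exact hyr.symm]
    rw [ind_eq_one, ind_eq_zero]
    simp [hrI, hqr.symm, hrs]
  · rw [ind_eq_zero]
    simp
  · intro X Y hX hY hIX hXY hYJ hXe hYe
    rw [hsum] at hXe hYe
    have hedges : ∀ Z : Graph α β, Z ≤ H.slice H.vertexSet D₀ → ∀ e ∈ Z.edgeSet,
        H.IsLink e x y → e = a ∨ e = b := by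
      intro Z hZ e he hl
      have := ((mem_edgeSet_slice hl).1 (hZ.edgeSet_mono he)).2.2
      by_contra hcon
      push Not at hcon
      exact this ⟨hl, hcon⟩
    -- The last two inequalities say that `Z` differs from the bottom and from the top.
    have facts : ∀ Z : Graph α β, Z.IsSemiInduced H → H.slice I D₁ < Z →
        Z < H.slice H.vertexSet D₀ →
        Z.ind (.inr a) ≤ Z.ind (.inl x) ∧ Z.ind (.inr a) ≤ Z.ind (.inl y) ∧
        Z.ind (.inr b) ≤ Z.ind (.inl x) ∧ Z.ind (.inr b) ≤ Z.ind (.inl y) ∧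
        Z.ind (.inl x) + Z.ind (.inl y) ≤ 1 + Z.ind (.inr a) + Z.ind (.inr b) ∧
        1 ≤ Z.ind (.inl x) + Z.ind (.inl y) + Z.ind (.inl q) + Z.ind (.inl r) ∧
        Z.ind (.inl x) + Z.ind (.inl y) + Z.ind (.inl q) + Z.ind (.inl r) + Z.ind (.inr a) +
          Z.ind (.inr b) ≤ 5 := by
      intro Z hZ hIZ hZJ
      refine ⟨(ind_edge_le hZ.1 ha).1, (ind_edge_le hZ.1 ha).2, (ind_edge_le hZ.1 hb).1,
        (ind_edge_le hZ.1 hb).2, ind_add_ind_le hZ ha (hedges Z hZJ.le), ?_, ?_⟩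
      · by_contra hcon
        have hx : x ∉ Z.vertexSet := inl_mem_parts.not.1 (ind_eq_zero.1 (by omega))
        have hy : y ∉ Z.vertexSet := inl_mem_parts.not.1 (ind_eq_zero.1 (by omega))
        have hq : q ∉ Z.vertexSet := inl_mem_parts.not.1 (ind_eq_zero.1 (by omega))
        have hr : r ∉ Z.vertexSet := inl_mem_parts.not.1 (ind_eq_zero.1 (by omega))
        refine hIZ.ne ((hsemi I hIH _ subset_rfl).eq_of_le hZ.1 hIZ.le ?_ ?_)
        · intro z hz
          have := hZ.1.vertexSet_mono hz
          rw [hVH] at this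
          rcases this with h | rfl | rfl | rfl | rfl
          · exact h
          all_goals contradiction
        · intro e he hm
          exact absurd ((hZ.1.isLink_iff he).2 (hmult e hm)).left_mem hx
      · have := ind_le_one Z (.inl x)
        have := ind_le_one Z (.inl y)
        have := ind_le_one Z (.inl q)
        have := ind_le_one Z (.inl r)
        have := ind_le_one Z (.inr a)
        have := ind_le_one Z (.inr b)
        by_contra hcon
        have hx : x ∈ Z.vertexSet := inl_mem_parts.1 (ind_eq_one.1 (by omega))
        have hy : y ∈ Z.vertexSet := inl_mem_parts.1 (ind_eq_one.1 (by omega))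
        have hq : q ∈ Z.vertexSet := inl_mem_parts.1 (ind_eq_one.1 (by omega))
        have hr : r ∈ Z.vertexSet := inl_mem_parts.1 (ind_eq_one.1 (by omega))
        have ha' : a ∈ Z.edgeSet := inr_mem_parts.1 (ind_eq_one.1 (by omega))
        have hb' : b ∈ Z.edgeSet := inr_mem_parts.1 (ind_eq_one.1 (by omega))
        refine hZJ.ne (hZ.eq_of_le (slice_le H _ subset_rfl) hZJ.le ?_ ?_)
        · rw [vertexSet_slice, hVH]
          rintro z (h | rfl | rfl | rfl | rfl)
          · exact hIZ.le.vertexSet_mono h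
          all_goals assumption
        · intro e he hm
          rcases hedges _ le_rfl e he (hmult e hm) with rfl | rfl <;> assumption
    obtain ⟨f1, f2, f3, f4, f5, f6, -⟩ := facts X hX hIX (hXY.trans hYJ)
    obtain ⟨g1, g2, g3, g4, g5, -, g7⟩ := facts Y hY (hIX.trans hXY) hYJ
    have m1 := ind_mono hXY.le (.inl x)
    have m2 := ind_mono hXY.le (.inl y)
    have m3 := ind_mono hXY.le (.inl q)
    have m4 := ind_mono hXY.le (.inl r)
    have m5 := ind_mono hXY.le (.inr a)
    have m6 := ind_mono hXY.le (.inr b)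
    have u1 := ind_le_one Y (.inl x)
    have u2 := ind_le_one Y (.inl y)
    have u3 := ind_le_one Y (.inl q)
    have u4 := ind_le_one Y (.inl r)
    exact branch_separation m1 m2 m3 m4 m5 m6 u1 u2 u3 u4 f1 f2 f3 f4 f5 f6 g1 g2 g3 g4 g5 g7
      hXe hYe

/-! ### Second obstruction: two bundles -/

/-- The variables are the indicators of `x, y, a, b, c, d, v`. The argument is that of
`branch_separation` with `c, d` in place of `q, r`. The indicator of `v` stays out of the parity sum
and only serves to detect the ends of the interval; this also allows `v = y`. -/
theorem bundle_separation {x₁ x₂ x₃ x₄ x₅ x₆ x₇ y₁ y₂ y₃ y₄ y₅ y₆ y₇ : ℕ}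
    (m1 : x₁ ≤ y₁) (m2 : x₂ ≤ y₂) (m3 : x₃ ≤ y₃) (m4 : x₄ ≤ y₄) (m5 : x₅ ≤ y₅) (m6 : x₆ ≤ y₆)
    (u1 : y₁ ≤ 1) (u2 : y₂ ≤ 1) (u5 : y₅ ≤ 1) (u6 : y₆ ≤ 1)
    (f1 : x₃ ≤ x₁) (f2 : x₃ ≤ x₂) (f3 : x₄ ≤ x₁) (f4 : x₄ ≤ x₂) (f5 : x₁ + x₂ ≤ 1 + x₃ + x₄)
    (f6 : 1 ≤ x₁ + x₂ + x₇) (f7 : x₇ ≤ x₅ + x₆)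
    (g1 : y₃ ≤ y₁) (g2 : y₃ ≤ y₂) (g3 : y₄ ≤ y₁) (g4 : y₄ ≤ y₂) (g5 : y₁ + y₂ ≤ 1 + y₃ + y₄)
    (g6 : y₅ ≤ y₇) (g7 : y₁ + y₂ + y₃ + y₄ + y₅ + y₆ + y₇ ≤ 6)
    (hX : Even (x₁ + x₂ + x₃ + x₄ + x₅ + x₆)) (hY : Even (y₁ + y₂ + y₃ + y₄ + y₅ + y₆)) :
    (x₅ = 1 ∧ x₆ = 0) ↔ (y₅ = 1 ∧ y₆ = 0) := by
  have hx5 : x₅ ≤ 1 := m5.trans u5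
  constructor
  · rintro ⟨h5, h6⟩
    have h5' : y₅ = 1 := le_antisymm u5 (h5 ▸ m5)
    refine ⟨h5', ?_⟩
    by_contra h6'
    have h6' : y₆ = 1 := by omega
    subst h5 h6 h5' h6'
    rcases zero_or_one_of_even u1 u2 g1 g2 g3 g4 g5 (by rw [Nat.even_iff] at *; omega) with
      ⟨rfl, rfl, rfl, rfl⟩ | ⟨rfl, rfl, rfl, rfl⟩
    · rw [Nat.even_iff] at hX
      omega
    · omega
  · rintro ⟨h5, h6⟩
    have h6' : x₆ = 0 := Nat.le_zero.1 (h6 ▸ m6)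
    refine ⟨?_, h6'⟩
    by_contra h5'
    have h5' : x₅ = 0 := by omega
    subst h5 h6 h5' h6'
    rcases zero_or_one_of_even (m1.trans u1) (m2.trans u2) f1 f2 f3 f4 f5
      (by rw [Nat.even_iff] at *; omega) with ⟨rfl, rfl, rfl, rfl⟩ | ⟨rfl, rfl, rfl, rfl⟩
    · omega
    · rw [Nat.even_iff] at hY
      omega

/-- A vertex incident to a bundle may be labelled or not, which leaves `u` free to correct the
parity of `I`. -/
theorem exists_even_ncard_subset {α : Type*} {I : Set α} (hI : I.Finite) {u : α} (hu : u ∈ I) :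
    ∃ I' ⊆ I, I \ {u} ⊆ I' ∧ Even I'.ncard := by
  by_cases h : Even I.ncard
  · exact ⟨I, subset_rfl, Set.sdiff_subset, h⟩
  · refine ⟨I \ {u}, Set.sdiff_subset, subset_rfl, ?_⟩
    have := Set.ncard_sdiff_singleton_add_one hu hI
    rw [← this, Nat.even_add_one, not_not] at h
    exact h

/-- An obstruction: two bundles, one between `x` and `y`, the other between `u` and `v`, where `u`
is in a connected set `I` of vertices to which `y` is attached. The two bundles may share the
vertex `y = v`. -/
theorem exists_not_isShellablePoset_of_bundles {α β : Type*} {H : Graph α β}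
    (hV : H.vertexSet.Finite) (hE : H.edgeSet.Finite) {I : Set α} {x y u v : α} {a b c d : β}
    (hVH : H.vertexSet = I ∪ {x, y, v}) (hxI : x ∉ I) (hyI : y ∉ I) (hvI : v ∉ I) (huI : u ∈ I)
    (hxy : x ≠ y) (hxv : x ≠ v) (hab : a ≠ b) (hcd : c ≠ d) (ha : H.IsLink a x y)
    (hb : H.IsLink b x y) (hc : H.IsLink c u v) (hd : H.IsLink d u v)
    (hmult : ∀ e, H.IsMultipleEdge e → H.IsLink e x y ∨ H.IsLink e u v)
    (hI : H.ConnOn I) (hyc : H.ConnOn (insert y I)) :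
    ∃ A, H.IsAdmissible A ∧ ¬ Shelling.IsShellablePoset (EvenPoset H A) := by
  classical
  have hIH : I ⊆ H.vertexSet := by rw [hVH]; exact Set.subset_union_left
  have hIfin : I.Finite := hV.subset hIH
  obtain ⟨I', hI'I, hI', hI'e⟩ := exists_even_ncard_subset hIfin huI
  have hux : u ≠ x := fun h => hxI (h ▸ huI)
  have huy : u ≠ y := fun h => hyI (h ▸ huI)
  have hxyuv : ∀ {e}, H.IsLink e x y → ¬ H.IsLink e u v := by
    intro e h1 h2
    rcases h2.left_eq_or_eq h1 with h | h
    · exact hux h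
    · exact huy h
  have hac : a ≠ c := fun h => hxyuv ha (h ▸ hc)
  have had : a ≠ d := fun h => hxyuv ha (h ▸ hd)
  have hbc : b ≠ c := fun h => hxyuv hb (h ▸ hc)
  have hbd : b ≠ d := fun h => hxyuv hb (h ▸ hd)
  have hyv : H.ConnOn (insert v (insert y I)) := hyc.insert (w := u) (by simp [huI]) hc.adj
  have hall : H.ConnOn H.vertexSet := by
    have := hyv.insert (w := y) (by simp) ha.symm.adj
    convert! this using 1
    rw [hVH]
    ext z
    simp only [Set.mem_union, Set.mem_insert_iff, Set.mem_singleton_iff]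
    tauto
  have hma : H.IsMultipleEdge a := ⟨b, hab.symm, x, y, ha, hb⟩
  have hmb : H.IsMultipleEdge b := ⟨a, hab, x, y, hb, ha⟩
  have hmc : H.IsMultipleEdge c := ⟨d, hcd.symm, u, v, hc, hd⟩
  have hmd : H.IsMultipleEdge d := ⟨c, hcd, u, v, hd, hc⟩
  have hxyI' : Sum.inl '' ({x, y} ∪ I') ⊆ (Sum.inl '' H.vertexSet : Set (α ⊕ β)) := by
    refine Set.image_mono (Set.union_subset ?_ (hI'I.trans hIH))
    rw [hVH]
    grind
  have hinter : ∀ {g h : β} {B : Set β}, (({a, b, c, d} : Set β) ∩ B = {g, h}) → g ≠ h →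
      ((Sum.inl '' ({x, y} ∪ I') ∪ Sum.inr '' {a, b, c, d}) ∩ Sum.inr '' B :
        Set (α ⊕ β)).Nonempty ∧
      Even ((Sum.inl '' ({x, y} ∪ I') ∪ Sum.inr '' {a, b, c, d}) ∩ Sum.inr '' B :
        Set (α ⊕ β)).ncard := by
    intro g h B hB hgh
    have : (Sum.inl '' ({x, y} ∪ I') ∪ Sum.inr '' {a, b, c, d}) ∩ Sum.inr '' B =
        (Sum.inr '' {g, h} : Set (α ⊕ β)) := by
      rw [← hB]
      ext (z | z)
      · simp
      · simp
    rw [this, Set.ncard_image_of_injective _ Sum.inr_injective, Set.ncard_pair hgh]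
    exact ⟨⟨_, g, by simp, rfl⟩, even_two⟩
  -- All ends of bundles are optional labels. Both `x` and `y` are taken, `u` according to parity,
  -- and `v` only if it equals `y`.
  refine ⟨Sum.inl '' ({x, y} ∪ I') ∪ Sum.inr '' {a, b, c, d},
    IsAdmissibleConnected.isAdmissible hall ⟨?_, ?_, ?_, ?_⟩, ?_⟩
  · refine Set.union_subset_union hxyI' (Set.image_mono ?_)
    rintro e (rfl | rfl | rfl | rfl) <;> assumption
  · have : (Sum.inl '' ({x, y} ∪ I') ∪ Sum.inr '' {a, b, c, d}) ∩ Sum.inl '' H.vertexSet =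
        (Sum.inl '' ({x, y} ∪ I') : Set (α ⊕ β)) := by
      rw [Set.union_inter_distrib_right, Set.inter_eq_left.2 hxyI']
      refine Set.union_eq_left.2 ?_
      rintro _ ⟨⟨e, -, rfl⟩, ⟨z, -, h⟩⟩
      cases h
    rw [this, Set.ncard_image_of_injective _ Sum.inl_injective,
      Set.ncard_union_eq _ (Set.toFinite _) (hIfin.subset hI'I), Set.ncard_pair hxy]
    · exact even_two.add hI'e
    · rw [Set.disjoint_left]
      rintro z (rfl | rfl) h
      · exact hxI (hI'I h)
      · exact hyI (hI'I h)
  · intro z hz hinc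
    rw [hVH] at hz
    refine Or.inl ⟨z, ?_, rfl⟩
    rcases hz with h | rfl | rfl | rfl
    · rcases eq_or_ne z u with rfl | hzu
      · exact absurd hmc (hinc c hc.inc_left)
      · exact Or.inr (hI' ⟨h, hzu⟩)
    · simp
    · simp
    · exact absurd hmc (hinc c hc.inc_right)
  · rintro B ⟨⟨e, he, f, hf, hef⟩, p, q, rfl⟩
    have hB : ∀ {g s t}, H.IsLink e s t → (g ∈ H.edgesBetween p q ↔ H.IsLink g s t) := by
      intro g s t hst
      rcases hst.eq_and_eq_or_eq_and_eq he with ⟨rfl, rfl⟩ | ⟨rfl, rfl⟩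
      · rfl
      · exact isLink_comm
    rcases hmult e ⟨f, hef.symm, p, q, he, hf⟩ with hl | hl
    · refine hinter (g := a) (h := b) ?_ hab
      ext g
      simp only [Set.mem_inter_iff, hB hl, Set.mem_insert_iff, Set.mem_singleton_iff]
      constructor
      · rintro ⟨rfl | rfl | rfl | rfl, h⟩
        · simp
        · simp
        · exact absurd hc (hxyuv h)
        · exact absurd hd (hxyuv h)
      · rintro (rfl | rfl) <;> simp [*]
    · refine hinter (g := c) (h := d) ?_ hcd
      ext g
      simp only [Set.mem_inter_iff, hB hl, Set.mem_insert_iff, Set.mem_singleton_iff]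
      constructor
      · rintro ⟨rfl | rfl | rfl | rfl, h⟩
        · exact absurd h (hxyuv ha)
        · exact absurd h (hxyuv hb)
        · simp
        · simp
      · rintro (rfl | rfl) <;> simp [*]
  -- Deleting `D₀` leaves two edges of each bundle, deleting `D₁ f` leaves `a` and one edge `f` of
  -- the second bundle, and deleting `D₂` leaves nothing of either.
  set D₀ : Set β :=
    {e | (H.IsLink e x y ∧ e ≠ a ∧ e ≠ b) ∨ (H.IsLink e u v ∧ e ≠ c ∧ e ≠ d)} with hD₀
  let D₁ : β → Set β := fun f => {e | (H.IsLink e x y ∧ e ≠ a) ∨ (H.IsLink e u v ∧ e ≠ f)}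
  set D₂ : Set β := {e | H.IsLink e x y ∨ H.IsLink e u v} with hD₂
  have hD₀₁ : ∀ f, f = c ∨ f = d → D₀ ⊆ D₁ f := by
    rintro f hf e (he | he)
    · exact Or.inl ⟨he.1, he.2.1⟩
    · exact Or.inr ⟨he.1, by rcases hf with rfl | rfl <;> [exact he.2.1; exact he.2.2]⟩
  have hD₁₂ : ∀ f, D₁ f ⊆ D₂ := by
    rintro f e (he | he)
    · exact Or.inl he.1
    · exact Or.inr he.1
  have hD₀₂ : D₀ ⊆ D₂ := (hD₀₁ c (Or.inl rfl)).trans (hD₁₂ c)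
  have hsemi : ∀ W ⊆ H.vertexSet, ∀ f, H.IsLink f u v → ∀ D ⊆ D₁ f,
      (H.slice W D).IsSemiInduced H := by
    intro W hW f hf D hD
    refine slice_isSemiInduced hW fun e he s _ t _ hst => ?_
    rcases hD he with hl | hl
    · refine ⟨a, fun h => ?_, ?_⟩
      · rcases hD h with h | h
        · exact h.2 rfl
        · exact hxyuv ha h.1
      · rcases hl.1.eq_and_eq_or_eq_and_eq hst with ⟨rfl, rfl⟩ | ⟨rfl, rfl⟩
        · exact ha
        · exact ha.symm
    · refine ⟨f, fun h => ?_, ?_⟩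
      · rcases hD h with h | h
        · exact hxyuv h.1 hf
        · exact h.2 rfl
      · rcases hl.1.eq_and_eq_or_eq_and_eq hst with ⟨rfl, rfl⟩ | ⟨rfl, rfl⟩
        · exact hf
        · exact hf.symm
  -- Neither bundle has both ends in `I`, so all their edges can be deleted there.
  have hIsemi : (H.slice I D₂).IsSemiInduced H := by
    refine slice_isSemiInduced hIH fun e he s hs t ht hst => ?_
    rcases he with h | h
    · rcases h.left_eq_or_eq hst with rfl | rfl <;> contradiction
    · rcases h.right_eq_or_eq hst with rfl | rfl <;> contradiction
  have hIxy : ∀ {e}, H.IsLink e x y → e ∉ (H.slice I D₂).edgeSet := fun he h =>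
    hxI ((mem_edgeSet_slice he).1 h).1
  have hIuv : ∀ {e}, H.IsLink e u v → e ∉ (H.slice I D₂).edgeSet := fun he h =>
    hvI ((mem_edgeSet_slice he).1 h).2.1
  have hsum : ∀ Z : Graph α β,
      ∑ d ∈ ({.inl x, .inl y, .inr a, .inr b, .inr c, .inr d} : Finset (α ⊕ β)), Z.ind d =
      Z.ind (.inl x) + Z.ind (.inl y) + Z.ind (.inr a) + Z.ind (.inr b) + Z.ind (.inr c) +
        Z.ind (.inr d) := by
    intro Z
    rw [Finset.sum_insert (by simp [hxy]), Finset.sum_insert (by simp),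
      Finset.sum_insert (by simp [hab, hac, had]), Finset.sum_insert (by simp [hbc, hbd]),
      Finset.sum_insert (by simp [hcd]), Finset.sum_singleton]
    ring
  have hxH : x ∈ H.vertexSet := ha.left_mem
  have hyH : y ∈ H.vertexSet := ha.right_mem
  have hvH : v ∈ H.vertexSet := hc.right_mem
  have huH : u ∈ H.vertexSet := hc.left_mem
  have hV1 : insert v (insert y I) ⊆ H.vertexSet := by
    rintro z (rfl | rfl | h)
    · exact hvH
    · exact hyH
    · exact hIH h
  have hIV1 : I ⊆ insert v (insert y I) := (Set.subset_insert _ _).trans (Set.subset_insert _ _)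
  have hx1 : x ∉ insert v (insert y I) := by simp [hxv, hxy, hxI]
  have haD₁ : ∀ f, a ∉ D₁ f := by
    rintro f (h | h)
    · exact h.2 rfl
    · exact hxyuv ha h.1
  have hbD₁ : ∀ f, b ∈ D₁ f := fun f => Or.inl ⟨hb, hab.symm⟩
  have hfD₁ : ∀ f, H.IsLink f u v → f ∉ D₁ f := by
    rintro f hf (h | h)
    · exact hxyuv h.1 hf
    · exact h.2 rfl
  have hD₀n : a ∉ D₀ ∧ b ∉ D₀ ∧ c ∉ D₀ ∧ d ∉ D₀ := by
    refine ⟨?_, ?_, ?_, ?_⟩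
    · rintro (h | h)
      · exact h.2.1 rfl
      · exact hxyuv ha h.1
    · rintro (h | h)
      · exact h.2.2 rfl
      · exact hxyuv hb h.1
    · rintro (h | h)
      · exact hxyuv h.1 hc
      · exact h.2.1 rfl
    · rintro (h | h)
      · exact hxyuv h.1 hd
      · exact h.2.2 rfl
  have hcD : c ∈ D₁ d := Or.inr ⟨hc, hcd⟩
  have hdC : d ∈ D₁ c := Or.inr ⟨hd, hcd.symm⟩
  -- The labels gained over `I` are `y, c` in `X₁` and `x, y, a, c` in `Y₁`; in `X₂` and `Y₂`, `d`
  -- replaces `c`.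
  refine not_isShellablePoset_of_slices hV hE (I := H.slice I D₂) (J := H.slice H.vertexSet D₀)
    (X₁ := H.slice (insert v (insert y I)) (D₁ c)) (Y₁ := H.slice H.vertexSet (D₁ c))
    (X₂ := H.slice (insert v (insert y I)) (D₁ d)) (Y₂ := H.slice H.vertexSet (D₁ d))
    {.inl x, .inl y, .inr a, .inr b, .inr c, .inr d} ?_ ?_ ?_ hIsemi hI ?_ ?_
    ?_ ?_ ?_ ?_ ?_ ?_ (fun X => X.ind (.inr c) = 1 ∧ X.ind (.inr d) = 0) ?_ ?_ ?_
  · simp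
  · simp [hxI, hyI, hIxy ha, hIxy hb, hIuv hc, hIuv hd]
  · rintro (z | z) hz hzA
    · rcases hzA with ⟨z', hz', h⟩ | ⟨z', -, h⟩
      · cases h
        rcases hz' with h | h
        · right
          simpa using h
        · left
          simpa using hI'I h
      · cases h
    · right
      simpa using hzA
  · have : (H.slice I D₂).parts ∩ (Sum.inl '' ({x, y} ∪ I') ∪ Sum.inr '' {a, b, c, d}) =
        Sum.inl '' I' := by
      ext (z | z)
      · simp only [Set.mem_inter_iff, inl_mem_parts, vertexSet_slice, Set.mem_union, Set.mem_image,
          Sum.inl.injEq, exists_eq_right, reduceCtorEq, and_false, exists_false, or_false,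
          Set.mem_insert_iff, Set.mem_singleton_iff]
        constructor
        · rintro ⟨h1, (rfl | rfl) | h⟩
          · contradiction
          · contradiction
          · exact h
        · exact fun h => ⟨hI'I h, Or.inr h⟩
      · simp only [Set.mem_inter_iff, inr_mem_parts, Set.mem_union, Set.mem_image, reduceCtorEq,
          and_false, exists_false, Sum.inr.injEq, exists_eq_right, false_or, iff_false, not_and]
        rintro h (rfl | rfl | rfl | rfl)
        · exact hIxy ha h
        · exact hIxy hb h
        · exact hIuv hc h
        · exact hIuv hd h
    rw [this, Set.ncard_image_of_injective _ Sum.inl_injective]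
    exact hI'e
  · intro Z hZ
    simp only [List.mem_cons, List.not_mem_nil, or_false] at hZ
    rw [hsum]
    rcases hZ with rfl | rfl | rfl | rfl | rfl
    · refine ⟨hsemi _ hV1 c hc _ subset_rfl, hyv, slice_mono H hIV1 (hD₁₂ c),
        slice_mono H hV1 (hD₀₁ c (Or.inl rfl)), ?_⟩
      rw [ind_slice_inr ha, ind_slice_inr hb, ind_slice_inr hc, ind_slice_inr hd]
      simp only [ind_slice_inl]
      simp only [hx1, hdC, hfD₁ c hc, huI, Set.mem_insert_iff, true_or, or_true,
        false_and, if_false]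
      decide
    · refine ⟨hsemi _ subset_rfl c hc _ subset_rfl, hall, slice_mono H hIH (hD₁₂ c),
        slice_mono H subset_rfl (hD₀₁ c (Or.inl rfl)), ?_⟩
      rw [ind_slice_inr ha, ind_slice_inr hb, ind_slice_inr hc, ind_slice_inr hd]
      simp only [ind_slice_inl]
      simp only [hxH, hyH, huH, hvH, haD₁, hbD₁, hdC, hfD₁ c hc]
      decide
    · refine ⟨hsemi _ hV1 d hd _ subset_rfl, hyv, slice_mono H hIV1 (hD₁₂ d),
        slice_mono H hV1 (hD₀₁ d (Or.inr rfl)), ?_⟩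
      rw [ind_slice_inr ha, ind_slice_inr hb, ind_slice_inr hc, ind_slice_inr hd]
      simp only [ind_slice_inl]
      simp only [hx1, hcD, hfD₁ d hd, huI, Set.mem_insert_iff, true_or, or_true,
        false_and, if_false]
      decide
    · refine ⟨hsemi _ subset_rfl d hd _ subset_rfl, hall, slice_mono H hIH (hD₁₂ d),
        slice_mono H subset_rfl (hD₀₁ d (Or.inr rfl)), ?_⟩
      rw [ind_slice_inr ha, ind_slice_inr hb, ind_slice_inr hc, ind_slice_inr hd]
      simp only [ind_slice_inl]
      simp only [hxH, hyH, huH, hvH, haD₁, hbD₁, hcD, hfD₁ d hd]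
      decide
    · refine ⟨hsemi _ subset_rfl c hc _ (hD₀₁ c (Or.inl rfl)), hall, slice_mono H hIH hD₀₂, le_rfl,
        ?_⟩
      rw [ind_slice_inr ha, ind_slice_inr hb, ind_slice_inr hc, ind_slice_inr hd]
      simp only [ind_slice_inl]
      simp only [hxH, hyH, huH, hvH, hD₀n]
      decide
  · exact lt_of_mem_parts (slice_mono H hIV1 (hD₁₂ c)) (z := .inl y) (by simp) (by simp [hyI])
  · exact lt_of_mem_parts (slice_mono H hV1 subset_rfl) (z := .inl x) (by simpa using hxH)
      (by simpa using hx1)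
  · refine lt_of_mem_parts (slice_mono H subset_rfl (hD₀₁ c (Or.inl rfl))) (z := .inr d) ?_ ?_
    · rw [inr_mem_parts, mem_edgeSet_slice hd]
      exact ⟨huH, hvH, hD₀n.2.2.2⟩
    · rw [inr_mem_parts, mem_edgeSet_slice hd]
      exact fun h => h.2.2 hdC
  · exact lt_of_mem_parts (slice_mono H hIV1 (hD₁₂ d)) (z := .inl y) (by simp) (by simp [hyI])
  · exact lt_of_mem_parts (slice_mono H hV1 subset_rfl) (z := .inl x) (by simpa using hxH)
      (by simpa using hx1)
  · refine lt_of_mem_parts (slice_mono H subset_rfl (hD₀₁ d (Or.inr rfl))) (z := .inr c) ?_ ?_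
    · rw [inr_mem_parts, mem_edgeSet_slice hc]
      exact ⟨huH, hvH, hD₀n.2.2.1⟩
    · rw [inr_mem_parts, mem_edgeSet_slice hc]
      exact fun h => h.2.2 hcD
  · rw [ind_eq_one, ind_eq_zero, inr_mem_parts, inr_mem_parts, mem_edgeSet_slice hc,
      mem_edgeSet_slice hd]
    exact ⟨⟨hIV1 huI, by simp, hfD₁ c hc⟩, fun h => h.2.2 hdC⟩
  · rw [ind_eq_one, inr_mem_parts, mem_edgeSet_slice hc]
    exact fun h => h.1.2.2 hcD
  · intro X Y hX hY hIX hXY hYJ hXe hYe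
    rw [hsum] at hXe hYe
    have hedges : ∀ Z : Graph α β, Z ≤ H.slice H.vertexSet D₀ → ∀ e ∈ Z.edgeSet,
        (H.IsLink e x y → e = a ∨ e = b) ∧ (H.IsLink e u v → e = c ∨ e = d) := by
      intro Z hZ e he
      obtain ⟨s, t, hst⟩ := exists_isLink_of_mem_edgeSet (hZ.edgeSet_mono he)
      have := (slice_isLink.1 hst).2.2.2
      constructor
      · intro hl
        by_contra hcon
        push Not at hcon
        exact this (Or.inl ⟨hl, hcon⟩)
      · intro hl
        by_contra hcon
        push Not at hcon
        exact this (Or.inr ⟨hl, hcon⟩)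
    have facts : ∀ Z : Graph α β, Z.IsSemiInduced H → H.slice I D₂ < Z →
        Z < H.slice H.vertexSet D₀ →
        Z.ind (.inr a) ≤ Z.ind (.inl x) ∧ Z.ind (.inr a) ≤ Z.ind (.inl y) ∧
        Z.ind (.inr b) ≤ Z.ind (.inl x) ∧ Z.ind (.inr b) ≤ Z.ind (.inl y) ∧
        Z.ind (.inl x) + Z.ind (.inl y) ≤ 1 + Z.ind (.inr a) + Z.ind (.inr b) ∧
        Z.ind (.inr c) ≤ Z.ind (.inl v) ∧
        Z.ind (.inl v) ≤ Z.ind (.inr c) + Z.ind (.inr d) ∧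
        1 ≤ Z.ind (.inl x) + Z.ind (.inl y) + Z.ind (.inl v) ∧
        Z.ind (.inl x) + Z.ind (.inl y) + Z.ind (.inr a) + Z.ind (.inr b) + Z.ind (.inr c) +
          Z.ind (.inr d) + Z.ind (.inl v) ≤ 6 := by
      intro Z hZ hIZ hZJ
      -- Since `u` is always present, `Z` contains `v` only along with `c` or `d`.
      have hu : Z.ind (.inl u) = 1 :=
        ind_eq_one.2 (inl_mem_parts.2 (hIZ.le.vertexSet_mono huI))
      have huv := ind_add_ind_le hZ hc fun e he => (hedges Z hZJ.le e he).2
      refine ⟨(ind_edge_le hZ.1 ha).1, (ind_edge_le hZ.1 ha).2, (ind_edge_le hZ.1 hb).1,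
        (ind_edge_le hZ.1 hb).2, ind_add_ind_le hZ ha fun e he => (hedges Z hZJ.le e he).1,
        (ind_edge_le hZ.1 hc).2, by omega, ?_, ?_⟩
      · by_contra hcon
        have hx : x ∉ Z.vertexSet := inl_mem_parts.not.1 (ind_eq_zero.1 (by omega))
        have hy : y ∉ Z.vertexSet := inl_mem_parts.not.1 (ind_eq_zero.1 (by omega))
        have hv : v ∉ Z.vertexSet := inl_mem_parts.not.1 (ind_eq_zero.1 (by omega))
        refine hIZ.ne (hIsemi.eq_of_le hZ.1 hIZ.le ?_ ?_)
        · intro z hz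
          have := hZ.1.vertexSet_mono hz
          rw [hVH] at this
          rcases this with h | rfl | rfl | rfl
          · exact h
          all_goals contradiction
        · intro e he hm
          rcases hmult e hm with h | h
          · exact absurd ((hZ.1.isLink_iff he).2 h).left_mem hx
          · exact absurd ((hZ.1.isLink_iff he).2 h).right_mem hv
      · have := ind_le_one Z (.inl x)
        have := ind_le_one Z (.inl y)
        have := ind_le_one Z (.inl v)
        have := ind_le_one Z (.inr a)
        have := ind_le_one Z (.inr b)
        have := ind_le_one Z (.inr c)
        have := ind_le_one Z (.inr d)
        by_contra hcon
        have hx : x ∈ Z.vertexSet := inl_mem_parts.1 (ind_eq_one.1 (by omega))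
        have hy : y ∈ Z.vertexSet := inl_mem_parts.1 (ind_eq_one.1 (by omega))
        have hv : v ∈ Z.vertexSet := inl_mem_parts.1 (ind_eq_one.1 (by omega))
        have ha' : a ∈ Z.edgeSet := inr_mem_parts.1 (ind_eq_one.1 (by omega))
        have hb' : b ∈ Z.edgeSet := inr_mem_parts.1 (ind_eq_one.1 (by omega))
        have hc' : c ∈ Z.edgeSet := inr_mem_parts.1 (ind_eq_one.1 (by omega))
        have hd' : d ∈ Z.edgeSet := inr_mem_parts.1 (ind_eq_one.1 (by omega))
        refine hZJ.ne (hZ.eq_of_le (slice_le H _ subset_rfl) hZJ.le ?_ ?_)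
        · rw [vertexSet_slice, hVH]
          rintro z (h | rfl | rfl | rfl)
          · exact hIZ.le.vertexSet_mono h
          all_goals assumption
        · intro e he hm
          rcases hmult e hm with h | h
          · rcases (hedges _ le_rfl e he).1 h with rfl | rfl <;> assumption
          · rcases (hedges _ le_rfl e he).2 h with rfl | rfl <;> assumption
    obtain ⟨f1, f2, f3, f4, f5, -, f7, f6, -⟩ := facts X hX hIX (hXY.trans hYJ)
    obtain ⟨g1, g2, g3, g4, g5, g6, -, -, g7⟩ := facts Y hY (hIX.trans hXY) hYJ
    exact bundle_separation (ind_mono hXY.le (.inl x)) (ind_mono hXY.le (.inl y))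
      (ind_mono hXY.le (.inr a)) (ind_mono hXY.le (.inr b)) (ind_mono hXY.le (.inr c))
      (ind_mono hXY.le (.inr d)) (ind_le_one Y _) (ind_le_one Y _) (ind_le_one Y _)
      (ind_le_one Y _) f1 f2 f3 f4 f5 f6 f7 g1 g2 g3 g4 g5 g6 g7 hXe hYe

/-! ### Obstructions in PI-graphs -/

/-- Every graph has a set of edges that contains exactly one edge between any two adjacent
vertices. -/
theorem exists_transversal {α β : Type*} (G : Graph α β) : ∃ R : Set β,
    (∀ e x y, G.IsLink e x y → ∃ f ∈ R, G.IsLink f x y) ∧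
    ∀ f ∈ R, ∀ g ∈ R, ∀ x y, G.IsLink f x y → G.IsLink g x y → f = g := by
  let T : Sym2 α → Set β := fun p => {e | ∃ x y, p = s(x, y) ∧ G.IsLink e x y}
  have hT : ∀ {p e x y}, e ∈ T p → G.IsLink e x y → p = s(x, y) := by
    rintro p e x y ⟨u, v, rfl, huv⟩ hxy
    exact huv.isLink_iff_sym2_eq.1 hxy
  refine ⟨{e | ∃ p, ∃ h : (T p).Nonempty, e = h.some}, ?_, ?_⟩
  · intro e x y he
    have hne : (T s(x, y)).Nonempty := ⟨e, x, y, rfl, he⟩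
    refine ⟨hne.some, ⟨_, hne, rfl⟩, ?_⟩
    obtain ⟨u, v, huv, hl⟩ := hne.some_mem
    exact hl.isLink_iff_sym2_eq.2 huv.symm
  · rintro f ⟨p, hp, rfl⟩ g ⟨q, hq, rfl⟩ x y hf hg
    obtain rfl : p = q := (hT hp.some_mem hf).trans (hT hq.some_mem hg).symm
    rfl

/-- A PI-graph with a prescribed vertex set all of whose bundles consist of edges in `M`. -/
theorem exists_isPIGraph {α β : Type*} (G : Graph α β) {M : Set β}
    (hM : ∀ e ∈ M, ∀ f x y, G.IsLink e x y → G.IsLink f x y → f ∈ M) {W : Set α}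
    (hW : W ⊆ G.vertexSet) : ∃ H : Graph α β, H.IsPIGraph G ∧ H.vertexSet = W ∧ H ≤ G ∧
      (∀ x ∈ W, ∀ y ∈ W, G.Adj x y → H.Adj x y) ∧
      (∀ e ∈ M, ∀ x ∈ W, ∀ y ∈ W, G.IsLink e x y → H.IsLink e x y) ∧
      ∀ e, H.IsMultipleEdge e → e ∈ M := by
  obtain ⟨R, hR, hR'⟩ := G.exists_transversal
  have hlink : ∀ {e x y}, (G.restrict (R ∪ M)).IsLink e x y ↔ G.IsLink e x y ∧ e ∈ R ∪ M := by
    intro e x y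
    simp [restrict, and_comm]
  have hind : ((G.restrict (R ∪ M)).induce W) ≤ G.restrict (R ∪ M) := induce_le hW
  -- Since `M` is closed under parallel edges, keeping `R ∪ M` preserves the bundles in `M` entirely
  -- and replaces each other bundle with its representative in `R`.
  refine ⟨(G.restrict (R ∪ M)).induce W, ⟨G.restrict (R ∪ M), ⟨⟨restrict_le, rfl⟩, ?_⟩,
    ⟨hind, fun e x y h hx hy => ⟨h, hx, hy⟩⟩⟩, rfl, hind.trans restrict_le, ?_, ?_, ?_⟩
  · intro x y
    by_cases hxy : ∃ e ∈ M, G.IsLink e x y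
    · obtain ⟨e, he, hel⟩ := hxy
      left
      ext f
      exact ⟨fun h => (hlink.1 h).1, fun h => hlink.2 ⟨h, Or.inr (hM e he f x y hel h)⟩⟩
    push Not at hxy
    by_cases hb : (G.edgesBetween x y).Nontrivial
    · right
      refine ⟨⟨hb, x, y, rfl⟩, ?_⟩
      obtain ⟨e, he⟩ := hb.nonempty
      obtain ⟨f, hf, hfl⟩ := hR e x y he
      refine ⟨f, ?_⟩
      ext g
      constructor
      · intro h
        obtain ⟨h1, h2 | h2⟩ := hlink.1 h
        · exact hR' g h2 f hf x y h1 hfl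
        · exact absurd h1 (hxy g h2)
      · rintro rfl
        exact hlink.2 ⟨hfl, Or.inl hf⟩
    · left
      rw [Set.not_nontrivial_iff] at hb
      ext e
      refine ⟨fun h => (hlink.1 h).1, fun h => ?_⟩
      obtain ⟨f, hf, hfl⟩ := hR e x y h
      have : f = e := hb hfl h
      exact hlink.2 ⟨h, Or.inl (this ▸ hf)⟩
  · rintro x hx y hy ⟨e, he⟩
    obtain ⟨f, hf, hfl⟩ := hR e x y he
    exact ⟨f, hlink.2 ⟨hfl, Or.inl hf⟩, hx, hy⟩
  · intro e he x hx y hy hl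
    exact ⟨hlink.2 ⟨hl, Or.inr he⟩, hx, hy⟩
  · rintro e ⟨f, hfe, x, y, ⟨he, -, -⟩, ⟨hf, -, -⟩⟩
    obtain ⟨he, he'⟩ := hlink.1 he
    obtain ⟨hf, hf'⟩ := hlink.1 hf
    by_contra heM
    have hfM : f ∉ M := fun h => heM (hM f h e x y hf he)
    exact hfe (hR' f (hf'.resolve_right hfM) e (he'.resolve_right heM) x y hf he)

theorem ConnOn.of_adj {α β : Type*} {G H : Graph α β} {W W' : Set α} (h : G.ConnOn W)
    (hW : W ⊆ W') (hadj : ∀ x ∈ W', ∀ y ∈ W', G.Adj x y → H.Adj x y) : H.ConnOn W :=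
  fun u hu v hv => (h u hu v hv).lift id fun _ _ hab =>
    ⟨hadj _ (hW hab.2.1) _ (hW hab.2.2) hab.1, hab.2⟩

/-- The configuration need not fill `G`, nor be free of other bundles: passing to a PI-graph
discards the other vertices and makes the other bundles simple, without changing adjacency. -/
theorem InGStar.false_of_branches {α β : Type*} {G : Graph α β} (hG : G.InGStar)
    (hV : G.vertexSet.Finite) (hE : G.edgeSet.Finite) {I : Set α} {x y q r s t : α} {a b : β}
    (hIV : I ⊆ G.vertexSet) (hqV : q ∈ G.vertexSet) (hrV : r ∈ G.vertexSet)
    (hxI : x ∉ I) (hyI : y ∉ I) (hqI : q ∉ I) (hrI : r ∉ I)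
    (hxy : x ≠ y) (hxq : x ≠ q) (hxr : x ≠ r) (hyq : y ≠ q) (hyr : y ≠ r) (hqr : q ≠ r)
    (hab : a ≠ b) (ha : G.IsLink a x y) (hb : G.IsLink b x y) (hIeven : Even I.ncard)
    (hs : s = x ∨ s = y) (ht : t = x ∨ t = y) (hI : G.ConnOn I) (hsq : G.ConnOn (I ∪ {s, q}))
    (htr : G.ConnOn (I ∪ {t, r})) : False := by
  have hM : ∀ e ∈ G.edgesBetween x y, ∀ f u v, G.IsLink e u v → G.IsLink f u v →
      f ∈ G.edgesBetween x y := by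
    intro e he f u v h1 h2
    exact h2.isLink_iff_sym2_eq.2 (h1.isLink_iff_sym2_eq.1 he)
  have hW : I ∪ {x, y, q, r} ⊆ G.vertexSet := by
    rintro z (h | rfl | rfl | rfl | rfl)
    · exact hIV h
    · exact ha.left_mem
    · exact ha.right_mem
    · exact hqV
    · exact hrV
  obtain ⟨H, hPI, hVH, hHG, hadj, hlink, hmult⟩ := exists_isPIGraph G hM hW
  have hx : x ∈ I ∪ {x, y, q, r} := by simp
  have hy : y ∈ I ∪ {x, y, q, r} := by simp
  obtain ⟨A, hA, hA'⟩ := exists_not_isShellablePoset_of_branches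
    (hV.subset hHG.vertexSet_mono) (hE.subset hHG.edgeSet_mono) hVH hxI hyI hqI hrI hxy hxq hxr hyq
    hyr hqr hab (hlink a ha x hx y hy ha) (hlink b hb x hx y hy hb)
    (fun e he => hlink e (hmult e he) x hx y hy (hmult e he)) hIeven hs ht
    (hI.of_adj Set.subset_union_left hadj)
    (hsq.of_adj (Set.union_subset_union_right _ (by rcases hs with rfl | rfl <;> grind)) hadj)
    (htr.of_adj (Set.union_subset_union_right _ (by rcases ht with rfl | rfl <;> grind)) hadj)
  exact hA' (hG H hPI A hA)

theorem InGStar.false_of_bundles {α β : Type*} {G : Graph α β} (hG : G.InGStar)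
    (hV : G.vertexSet.Finite) (hE : G.edgeSet.Finite) {I : Set α} {x y u v : α} {a b c d : β}
    (hIV : I ⊆ G.vertexSet) (hxI : x ∉ I) (hyI : y ∉ I) (hvI : v ∉ I) (huI : u ∈ I)
    (hxy : x ≠ y) (hxv : x ≠ v) (hab : a ≠ b) (hcd : c ≠ d) (ha : G.IsLink a x y)
    (hb : G.IsLink b x y) (hc : G.IsLink c u v) (hd : G.IsLink d u v)
    (hI : G.ConnOn I) (hyc : G.ConnOn (insert y I)) : False := by
  have hM : ∀ e ∈ G.edgesBetween x y ∪ G.edgesBetween u v, ∀ f s t, G.IsLink e s t →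
      G.IsLink f s t → f ∈ G.edgesBetween x y ∪ G.edgesBetween u v := by
    rintro e (he | he) f s t h1 h2
    · exact Or.inl (h2.isLink_iff_sym2_eq.2 (h1.isLink_iff_sym2_eq.1 he))
    · exact Or.inr (h2.isLink_iff_sym2_eq.2 (h1.isLink_iff_sym2_eq.1 he))
  have hW : I ∪ {x, y, v} ⊆ G.vertexSet := by
    rintro z (h | rfl | rfl | rfl)
    · exact hIV h
    · exact ha.left_mem
    · exact ha.right_mem
    · exact hc.right_mem
  obtain ⟨H, hPI, hVH, hHG, hadj, hlink, hmult⟩ := exists_isPIGraph G hM hW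
  have hx : x ∈ I ∪ {x, y, v} := by simp
  have hy : y ∈ I ∪ {x, y, v} := by simp
  have hu : u ∈ I ∪ {x, y, v} := Or.inl huI
  have hv : v ∈ I ∪ {x, y, v} := by simp
  obtain ⟨A, hA, hA'⟩ := exists_not_isShellablePoset_of_bundles
    (hV.subset hHG.vertexSet_mono) (hE.subset hHG.edgeSet_mono) hVH hxI hyI hvI huI hxy hxv hab hcd
    (hlink a (Or.inl ha) x hx y hy ha) (hlink b (Or.inl hb) x hx y hy hb)
    (hlink c (Or.inr hc) u hu v hv hc) (hlink d (Or.inr hd) u hu v hv hd)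
    (fun e he => (hmult e he).imp (fun h => hlink e (Or.inl h) x hx y hy h)
      fun h => hlink e (Or.inr h) u hu v hv h)
    (hI.of_adj Set.subset_union_left hadj)
    (hyc.of_adj (Set.insert_subset hy Set.subset_union_left) hadj)
  exact hA' (hG H hPI A hA)

/-! ### Uniqueness of the bundle -/

/-- A walk from `S` to `T` contains a connected set attached to `S` that meets `T` in a single
vertex. -/
theorem exists_connOn_between {α β : Type*} {G : Graph α β} {S T : Set α} {x z : α} (hx : x ∈ S)
    (hz : z ∈ T) (hST : Disjoint S T) (h : Relation.ReflTransGen G.Adj x z) :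
    ∃ I : Set α, ∃ t ∈ I, t ∈ T ∧ I ⊆ G.vertexSet ∧ G.ConnOn I ∧ Disjoint I S ∧
      (∀ w ∈ I, w ∈ T → w = t) ∧ ∃ s ∈ S, ∃ w ∈ I, G.Adj s w := by
  by_contra hcon
  -- The connected set records the walk since it last left `S`. It starts afresh after each visit to
  -- `S`, and reaching `T` would produce the required set.
  have key : ∀ w, Relation.ReflTransGen G.Adj x w → w ∈ S ∨
      ∃ I : Set α, w ∈ I ∧ I ⊆ G.vertexSet ∧ G.ConnOn I ∧ Disjoint I S ∧
        (∀ w' ∈ I, w' ∈ T → w' = w) ∧ ∃ s ∈ S, ∃ w ∈ I, G.Adj s w := by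
    intro w hw
    induction hw with
    | refl => exact Or.inl hx
    | @tail w w' _ hww' ih =>
      by_cases hw'S : w' ∈ S
      · exact Or.inl hw'S
      right
      rcases ih with hwS | ⟨I, hwI, hIV, hIc, hIS, hIT, s, hs, v, hv, hsv⟩
      · refine ⟨{w'}, rfl, by simpa using hww'.right_mem, connOn_singleton G w', by simpa using hw'S,
          fun v hv _ => hv, w, hwS, w', rfl, hww'⟩
      · have hwT : w ∉ T := fun hwT =>
          hcon ⟨I, w, hwI, hwT, hIV, hIc, hIS, hIT, s, hs, v, hv, hsv⟩
        refine ⟨insert w' I, by simp, Set.insert_subset hww'.right_mem hIV, hIc.insert hwI hww', ?_,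
          ?_, s, hs, v, by simp [hv], hsv⟩
        · rw [Set.disjoint_insert_left]
          exact ⟨hw'S, hIS⟩
        · rintro v' (rfl | hv') hv'T
          · rfl
          · exact absurd (hIT v' hv' hv'T ▸ hv'T) hwT
  rcases key z h with h | ⟨I, h1, h2, h3, h4, h5, h6⟩
  · exact Set.disjoint_left.1 hST h hz
  · exact hcon ⟨I, z, h1, hz, h2, h3, h4, h5, h6⟩

/-- A connected graph in `𝒢*` has at most one bundle. -/
theorem InGStar.bundle_unique {α β : Type*} {G : Graph α β} (hG : G.InGStar)
    (hV : G.vertexSet.Finite) (hE : G.edgeSet.Finite) (hloop : G.Loopless)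
    (hconn : G.IsConnectedGraph) {x y u v : α} {a b c d : β} (hab : a ≠ b) (hcd : c ≠ d)
    (ha : G.IsLink a x y) (hb : G.IsLink b x y) (hc : G.IsLink c u v) (hd : G.IsLink d u v) :
    s(u, v) = s(x, y) := by
  have hxy : x ≠ y := ha.ne
  have huv : u ≠ v := hc.ne
  -- For two bundles with a common end `y`, the connected set is the single vertex `u`, and `v = y`.
  have share : ∀ {x y u : α}, G.IsLink a x y → G.IsLink b x y → G.IsLink c u y →
      G.IsLink d u y → u = x := by
    intro x y u ha hb hc hd
    by_contra hux
    refine hG.false_of_bundles hV hE (I := {u}) (v := y) (by simpa using hc.left_mem)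
      (by simpa using fun h => hux h.symm) (by simpa using hc.ne.symm) (by simpa using hc.ne.symm)
      rfl ha.ne ha.ne hab hcd ha hb hc hd (connOn_singleton G u) (connOn_pair hc.symm.adj)
  by_cases hdisj : Disjoint ({x, y} : Set α) {u, v}
  · exfalso
    obtain ⟨I, t, htI, htT, hIV, hIc, hIS, hIT, s, hs, w, hw, hsw⟩ :=
      exists_connOn_between (x := x) (z := u) (by simp) (by simp) hdisj
        (hconn.2 x ha.left_mem u hc.left_mem)
    -- For disjoint bundles, the ends are renamed so that `u` is the end of the second bundle in `I`
    -- and `y` is the end of the first one attached to `I`.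
    have key : ∀ {x y u v : α}, G.IsLink a x y → G.IsLink b x y → G.IsLink c u v →
        G.IsLink d u v → u ∈ I → y = s → x ∉ I → y ∉ I → v ∉ I → x ≠ v → False := by
      intro x y u v ha hb hc hd hu hys hx hy hv hxv
      exact hG.false_of_bundles hV hE hIV hx hy hv hu ha.ne hxv hab hcd ha hb hc hd hIc
        (hIc.insert hw (hys ▸ hsw.symm))
    have hxI : x ∉ I := fun h => Set.disjoint_left.1 hIS h (by simp)
    have hyI : y ∉ I := fun h => Set.disjoint_left.1 hIS h (by simp)
    simp only [Set.disjoint_left, Set.mem_insert_iff, Set.mem_singleton_iff, not_or, forall_eq_or_imp,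
      forall_eq] at hdisj
    rcases htT with rfl | rfl
    · have hvI : v ∉ I := fun h => huv (hIT v h (by simp)).symm
      rcases hs with rfl | rfl
      · exact key ha.symm hb.symm hc hd htI rfl hyI hxI hvI hdisj.2.2
      · exact key ha hb hc hd htI rfl hxI hyI hvI hdisj.1.2
    · have huI : u ∉ I := fun h => huv (hIT u h (by simp))
      rcases hs with rfl | rfl
      · exact key ha.symm hb.symm hc.symm hd.symm htI rfl hyI hxI huI hdisj.2.1
      · exact key ha hb hc.symm hd.symm htI rfl hxI hyI huI hdisj.1.1
  · obtain ⟨z, hz, hz'⟩ := Set.not_disjoint_iff.1 hdisj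
    rcases hz with rfl | rfl <;> rcases hz' with rfl | rfl
    · rw [share ha.symm hb.symm hc.symm hd.symm]
    · rw [share ha.symm hb.symm hc hd, Sym2.eq_swap]
    · rw [share ha hb hc.symm hd.symm, Sym2.eq_swap]
    · rw [share ha hb hc hd]

/-! ### Recognition of the six families -/

/-- A criterion for a graph to be isomorphic to `withBundle n m S`. -/
theorem isomorphic_withBundle {α β : Type*} {G : Graph α β} (hloop : G.Loopless)
    (hE : G.edgeSet.Finite) {n m : ℕ} {S : Set (Sym2 ℕ)} {f : ℕ → α} (hn : 2 ≤ n)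
    (hinj : ∀ i < n, ∀ j < n, f i = f j → i = j) (hV : ∀ z, z ∈ G.vertexSet ↔ ∃ i < n, z = f i)
    (hm : (G.edgesBetween (f 0) (f 1)).ncard = m) (h01 : s(0, 1) ∉ S) (hdiag : ∀ i, s(i, i) ∉ S)
    (hadj : ∀ i j, i < j → j < n → ¬ (i = 0 ∧ j = 1) → (G.Adj (f i) (f j) ↔ s(i, j) ∈ S))
    (huniq : ∀ e e' u v, e ≠ e' → G.IsLink e u v → G.IsLink e' u v → s(u, v) = s(f 0, f 1)) :
    G.Isomorphic (withBundle n m S) := by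
  classical
  have hfV : ∀ i < n, f i ∈ G.vertexSet := fun i hi => (hV _).2 ⟨i, hi, rfl⟩
  have hs2 : ∀ {i j k l}, i < n → j < n → k < n → l < n → s(f i, f j) = s(f k, f l) →
      s(i, j) = s(k, l) := by
    intro i j k l hi hj hk hl h
    rw [Sym2.eq_iff] at h ⊢
    rcases h with ⟨h1, h2⟩ | ⟨h1, h2⟩
    · exact Or.inl ⟨hinj i hi k hk h1, hinj j hj l hl h2⟩
    · exact Or.inr ⟨hinj i hi l hl h1, hinj j hj k hk h2⟩
  have hadj' : ∀ i j, i < n → j < n → s(i, j) ≠ s(0, 1) →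
      (G.Adj (f i) (f j) ↔ s(i, j) ∈ S) := by
    intro i j hi hj hne
    rcases lt_trichotomy i j with h | rfl | h
    · refine hadj i j h hj ?_
      rintro ⟨rfl, rfl⟩
      exact hne rfl
    · exact iff_of_false (G.not_adj_self _) (hdiag i)
    · rw [adj_comm, Sym2.eq_swap]
      refine hadj j i h hi ?_
      rintro ⟨rfl, rfl⟩
      exact hne Sym2.eq_swap
  have hBfin : (G.edgesBetween (f 0) (f 1)).Finite :=
    hE.subset fun e (he : G.IsLink e (f 0) (f 1)) => he.edge_mem
  have := hBfin.to_subtype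
  let b : G.edgesBetween (f 0) (f 1) ≃ Fin m := Finite.equivFinOfCardEq hm
  -- The pair `p e` holds the indices of the ends of `e`; `s(0, 0)` is a dummy value for an `e` that
  -- is not an edge between listed vertices.
  have hpex : ∀ e, ∃ p : Sym2 ℕ, ∀ i < n, ∀ j < n, G.IsLink e (f i) (f j) → p = s(i, j) := by
    intro e
    by_cases h : ∃ i j, i < n ∧ j < n ∧ G.IsLink e (f i) (f j)
    · obtain ⟨i, j, hi, hj, h⟩ := h
      exact ⟨s(i, j), fun k hk l hl h' => hs2 hi hj hk hl (h.isLink_iff_sym2_eq.1 h')⟩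
    · exact ⟨s(0, 0), fun i hi j hj h' => (h ⟨i, j, hi, hj, h'⟩).elim⟩
  choose p hp using hpex
  -- Edges of the bundle are numbered by `b`. Every other edge is determined by its ends, by
  -- `huniq`.
  let g : β → ℕ ⊕ Sym2 ℕ := fun e =>
    if h : G.IsLink e (f 0) (f 1) then Sum.inl (b ⟨e, h⟩ : ℕ) else Sum.inr (p e)
  have hgpos : ∀ {e} (h : G.IsLink e (f 0) (f 1)), g e = Sum.inl (b ⟨e, h⟩ : ℕ) :=
    fun h => dif_pos h
  have hgneg : ∀ {e}, ¬ G.IsLink e (f 0) (f 1) → g e = Sum.inr (p e) := fun h => dif_neg h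
  have hex : ∀ {e}, e ∈ G.edgeSet → ∃ i j, i < n ∧ j < n ∧ G.IsLink e (f i) (f j) := by
    intro e he
    obtain ⟨u, v, huv⟩ := exists_isLink_of_mem_edgeSet he
    obtain ⟨i, hi, rfl⟩ := (hV u).1 huv.left_mem
    obtain ⟨j, hj, rfl⟩ := (hV v).1 huv.right_mem
    exact ⟨i, j, hi, hj, huv⟩
  have key : ∀ e ∈ G.edgeSet, ∀ i < n, ∀ j < n,
      (G.IsLink e (f i) (f j) ↔ (withBundle n m S).IsLink (g e) i j) := by
    intro e he i hi j hj
    by_cases h : G.IsLink e (f 0) (f 1)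
    · rw [hgpos h, h.isLink_iff_sym2_eq]
      constructor
      · intro h'
        exact ⟨hi, hj, Or.inl ⟨_, (b ⟨e, h⟩).2, rfl, (hs2 (by omega) (by omega) hi hj h').symm⟩⟩
      · rintro ⟨-, -, ⟨_, -, -, h'⟩ | ⟨-, h'⟩⟩
        · rcases Sym2.eq_iff.1 h' with ⟨rfl, rfl⟩ | ⟨rfl, rfl⟩
          · rfl
          · exact Sym2.eq_swap
        · cases h'
    · rw [hgneg h]
      constructor
      · intro h'
        refine ⟨hi, hj, Or.inr ⟨(hadj' i j hi hj fun hij => h ?_).1 h'.adj,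
          congrArg _ (hp e i hi j hj h')⟩⟩
        rcases Sym2.eq_iff.1 hij with ⟨rfl, rfl⟩ | ⟨rfl, rfl⟩
        · exact h'
        · exact h'.symm
      · rintro ⟨-, -, ⟨_, -, h', -⟩ | ⟨-, h'⟩⟩
        · cases h'
        · obtain ⟨k, l, hk, hl, hkl⟩ := hex he
          have := (hp e k hk l hl hkl).symm.trans (Sum.inr.inj h')
          rcases Sym2.eq_iff.1 this with ⟨rfl, rfl⟩ | ⟨rfl, rfl⟩
          · exact hkl
          · exact hkl.symm
  have hgmem : ∀ e ∈ G.edgeSet, g e ∈ (withBundle n m S).edgeSet := by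
    intro e he
    obtain ⟨i, j, hi, hj, h⟩ := hex he
    exact ((key e he i hi j hj).1 h).edge_mem
  let g' : G.edgeSet → (withBundle n m S).edgeSet := fun e => ⟨g e, hgmem e e.2⟩
  have hg' : Function.Bijective g' := by
    constructor
    · rintro ⟨e, he⟩ ⟨e', he'⟩ hee
      have hee : g e = g e' := congrArg Subtype.val hee
      refine Subtype.ext ?_
      change e = e'
      obtain ⟨i, j, hi, hj, h⟩ := hex he
      have h' : G.IsLink e' (f i) (f j) := by
        rw [key e' he' i hi j hj, ← hee, ← key e he i hi j hj]
        exact h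
      by_contra hne
      have h01 := huniq e e' _ _ hne h h'
      have h1 := h.isLink_iff_sym2_eq.2 h01
      have h2 := h'.isLink_iff_sym2_eq.2 h01
      rw [hgpos h1, hgpos h2] at hee
      have := b.injective (Fin.ext (Sum.inl.inj hee))
      exact hne (congrArg Subtype.val this)
    · rintro ⟨e, he⟩
      obtain ⟨i, j, hi, hj, h⟩ := exists_isLink_of_mem_edgeSet he
      rcases h with ⟨k, hk, rfl, -⟩ | ⟨hS, rfl⟩
      · have hl := (b.symm ⟨k, hk⟩).2
        refine ⟨⟨_, IsLink.edge_mem hl⟩, Subtype.ext ?_⟩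
        change g _ = _
        rw [hgpos hl]
        simp
      · have hne : s(i, j) ≠ s(0, 1) := fun h => h01 (h ▸ hS)
        obtain ⟨e, he⟩ := (hadj' i j hi hj hne).2 hS
        refine ⟨⟨e, he.edge_mem⟩, Subtype.ext ?_⟩
        change g e = _
        rw [hgneg, hp e i hi j hj he]
        intro h
        exact hne (hs2 hi hj (by omega) (by omega) (he.isLink_iff_sym2_eq.1 h))
  let f' : (withBundle n m S).vertexSet → G.vertexSet := fun i => ⟨f i, hfV i i.2⟩
  have hf' : Function.Bijective f' := by
    constructor
    · rintro ⟨i, hi⟩ ⟨j, hj⟩ h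
      exact Subtype.ext (hinj i hi j hj (congrArg Subtype.val h))
    · rintro ⟨z, hz⟩
      obtain ⟨i, hi, rfl⟩ := (hV z).1 hz
      exact ⟨⟨i, hi⟩, rfl⟩
  refine ⟨(Equiv.ofBijective f' hf').symm, Equiv.ofBijective g' hg', ?_⟩
  intro e u v
  obtain ⟨i, rfl⟩ := (Equiv.ofBijective f' hf').surjective u
  obtain ⟨j, rfl⟩ := (Equiv.ofBijective f' hf').surjective v
  rw [Equiv.symm_apply_apply, Equiv.symm_apply_apply]
  exact key e e.2 i i.2 j j.2

theorem mk_mem_pathEdges {k i j : ℕ} (hij : i < j) :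
    s(i, j) ∈ pathEdges k ↔ 1 ≤ i ∧ j ≤ k ∧ j = i + 1 := by
  constructor
  · rintro ⟨l, h1, h2, h⟩
    rcases Sym2.eq_iff.1 h with ⟨rfl, rfl⟩ | ⟨rfl, rfl⟩ <;> omega
  · rintro ⟨h1, h2, rfl⟩
    exact ⟨i, h1, h2, rfl⟩

theorem diag_notMem_pathEdges {k i : ℕ} : s(i, i) ∉ pathEdges k := by
  rintro ⟨l, h1, h2, h⟩
  rcases Sym2.eq_iff.1 h with ⟨rfl, h⟩ | ⟨rfl, h⟩ <;> omega

/-- The version of `isomorphic_withBundle` that leaves open whether `0` and `2` are adjacent. -/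
theorem isomorphic_withBundle_or {α β : Type*} {G : Graph α β} (hloop : G.Loopless)
    (hE : G.edgeSet.Finite) {n : ℕ} {S : Set (Sym2 ℕ)} {f : ℕ → α} (hn : 3 ≤ n)
    (hinj : ∀ i < n, ∀ j < n, f i = f j → i = j) (hV : ∀ z, z ∈ G.vertexSet ↔ ∃ i < n, z = f i)
    (h01 : s(0, 1) ∉ S) (h02 : s(0, 2) ∉ S) (hdiag : ∀ i, s(i, i) ∉ S)
    (hadj : ∀ i j, i < j → j < n → ¬ (i = 0 ∧ j = 1) → ¬ (i = 0 ∧ j = 2) →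
      (G.Adj (f i) (f j) ↔ s(i, j) ∈ S))
    (huniq : ∀ e e' u v, e ≠ e' → G.IsLink e u v → G.IsLink e' u v → s(u, v) = s(f 0, f 1)) :
    G.Isomorphic (withBundle n (G.edgesBetween (f 0) (f 1)).ncard S) ∨
      G.Isomorphic (withBundle n (G.edgesBetween (f 0) (f 1)).ncard (S ∪ {s(0, 2)})) := by
  by_cases h : G.Adj (f 0) (f 2)
  · right
    refine isomorphic_withBundle hloop hE (by omega) hinj hV rfl ?_ ?_ ?_ huniq
    · simp [h01]
    · intro i
      simp only [Set.mem_union, hdiag, Set.mem_singleton_iff, false_or, Sym2.eq_iff]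
      omega
    · intro i j hij hj h'
      by_cases hne02 : i = 0 ∧ j = 2
      · obtain ⟨rfl, rfl⟩ := hne02
        simp [h]
      · rw [hadj i j hij hj h' hne02]
        simp only [Set.mem_union, Set.mem_singleton_iff, Sym2.eq_iff, iff_self_or]
        omega
  · left
    refine isomorphic_withBundle hloop hE (by omega) hinj hV rfl h01 hdiag ?_ huniq
    intro i j hij hj h'
    by_cases hne02 : i = 0 ∧ j = 2
    · obtain ⟨rfl, rfl⟩ := hne02
      simp [h, h02]
    · exact hadj i j hij hj h' hne02

/-! ### Trunks and their possible ends -/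

/-- The vertices `f 0, …, f k` induce a path, up to the adjacency of `f 0` and `f 2`, and only the
last one has neighbours outside. -/
structure IsTrunk {α β : Type*} (G : Graph α β) (k : ℕ) (f : ℕ → α) : Prop where
  two_le : 2 ≤ k
  mem : ∀ i ≤ k, f i ∈ G.vertexSet
  inj : ∀ i ≤ k, ∀ j ≤ k, f i = f j → i = j
  adj : ∀ i, 1 ≤ i → i < k → G.Adj (f i) (f (i + 1))
  eq_of_adj : ∀ i j, i < j → j ≤ k → ¬ (i = 0 ∧ j = 2) → G.Adj (f i) (f j) → j = i + 1
  out : ∀ z, (∀ i ≤ k, z ≠ f i) → ∀ i < k, ¬ G.Adj (f i) z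

/-- A set of vertices of a connected graph with no neighbours outside is the whole vertex set. -/
theorem IsConnectedGraph.mem_of_closed {α β : Type*} {G : Graph α β} (hG : G.IsConnectedGraph)
    {S : Set α} {x : α} (hxV : x ∈ G.vertexSet) (hx : x ∈ S)
    (hS : ∀ u ∈ S, ∀ v, G.Adj u v → v ∈ S) {z : α} (hz : z ∈ G.vertexSet) : z ∈ S := by
  have := hG.2 x hxV z hz
  clear hz
  induction this with
  | refl => exact hx
  | tail _ h ih => exact hS _ ih _ h

/-- The segment `f 2, …, f j` of a trunk. -/
theorem IsTrunk.connOn_segment {α β : Type*} {G : Graph α β} {k : ℕ} {f : ℕ → α}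
    (h : G.IsTrunk k f) {j : ℕ} (h2 : 2 ≤ j) (hj : j ≤ k) : G.ConnOn (f '' Set.Icc 2 j) := by
  induction j, h2 using Nat.le_induction with
  | base => simpa using connOn_singleton G (f 2)
  | succ j h2 ih =>
    have := (ih (by omega)).insert (w := f j) ⟨j, ⟨h2, le_rfl⟩, rfl⟩ (h.adj j (by omega) (by omega))
    rw [← Set.image_insert_eq] at this
    convert! this using 2
    ext i
    simp only [Set.mem_Icc, Set.mem_insert_iff]
    omega

theorem IsTrunk.ncard_segment {α β : Type*} {G : Graph α β} {k : ℕ} {f : ℕ → α}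
    (h : G.IsTrunk k f) : (f '' Set.Icc 2 k).ncard = k - 1 := by
  have hinj : Set.InjOn f (Set.Icc 2 k) := fun i hi j hj hij => h.inj i hi.2 j hj.2 hij
  rw [hinj.ncard_image, ← Finset.coe_Icc, Set.ncard_coe_finset, Nat.card_Icc]
  omega

/-- The six families, as the conclusion of the classification. -/
def IsTilde {α β : Type*} (G : Graph α β) : Prop :=
  ∃ n m : ℕ, 2 ≤ m ∧
    ((2 ≤ n ∧ G.Isomorphic (tildeP n m)) ∨
      (5 ≤ n ∧ Odd n ∧ G.Isomorphic (tildeS n m)) ∨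
      (5 ≤ n ∧ Odd n ∧ G.Isomorphic (tildeT n m)) ∨
      (3 ≤ n ∧ G.Isomorphic (tildeP' n m)) ∨
      (5 ≤ n ∧ Odd n ∧ G.Isomorphic (tildeS' n m)) ∨
      (5 ≤ n ∧ Odd n ∧ G.Isomorphic (tildeT' n m)))

/-- The trunk is closed under adjacency, so by connectedness it is the whole graph, on `k + 1`
vertices. -/
theorem IsTrunk.isTilde_of_no_neighbour {α β : Type*} {G : Graph α β} (hE : G.edgeSet.Finite)
    (hloop : G.Loopless) (hconn : G.IsConnectedGraph) {k : ℕ} {f : ℕ → α} (h : G.IsTrunk k f)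
    (hm : 2 ≤ (G.edgesBetween (f 0) (f 1)).ncard)
    (huniq : ∀ e e' u v, e ≠ e' → G.IsLink e u v → G.IsLink e' u v → s(u, v) = s(f 0, f 1))
    (hout : ∀ z, (∀ i ≤ k, z ≠ f i) → ¬ G.Adj (f k) z) : G.IsTilde := by
  have h2 := h.two_le
  have hV : ∀ z, z ∈ G.vertexSet ↔ ∃ i < k + 1, z = f i := by
    intro z
    constructor
    · intro hz
      refine hconn.mem_of_closed (S := {z | ∃ i < k + 1, z = f i}) (h.mem 0 (by omega))
        ⟨0, by omega, rfl⟩ ?_ hz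
      rintro _ ⟨i, hi, rfl⟩ v hv
      by_contra hcon
      have hcon' : ∀ j ≤ k, v ≠ f j := fun j hj hvj => hcon ⟨j, by omega, hvj⟩
      rcases Nat.lt_or_ge i k with hik | hik
      · exact h.out v hcon' i hik hv
      · obtain rfl : i = k := by omega
        exact hout v hcon' hv
    · rintro ⟨i, hi, rfl⟩
      exact h.mem i (by omega)
  have := isomorphic_withBundle_or hloop hE (n := k + 1) (S := pathEdges k) (f := f) (by omega)
    (fun i hi j hj => h.inj i (by omega) j (by omega)) hV
    (by rw [mk_mem_pathEdges (by omega)]; omega) (by rw [mk_mem_pathEdges (by omega)]; omega)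
    (fun i => diag_notMem_pathEdges) ?_ huniq
  · refine ⟨k + 1, _, hm, ?_⟩
    rcases this with h | h
    · exact Or.inl ⟨by omega, h⟩
    · exact Or.inr (Or.inr (Or.inr (Or.inl ⟨by omega, h⟩)))
  · intro i j hij hj h01 h02
    rw [mk_mem_pathEdges hij]
    constructor
    · intro hadj
      have := h.eq_of_adj i j hij (by omega) h02 hadj
      omega
    · rintro ⟨h1, h2, rfl⟩
      exact h.adj i h1 (by omega)

/-- Trunk, `p` and `q` are together closed under adjacency, so they exhaust the graph. It has `n = k
+ 3` vertices, with the fork at `k = n - 3`; whether `p` and `q` are adjacent separates the families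
T from the families S. -/
theorem IsTrunk.isTilde_of_fork {α β : Type*} {G : Graph α β} (hE : G.edgeSet.Finite)
    (hloop : G.Loopless) (hconn : G.IsConnectedGraph) {k : ℕ} {f : ℕ → α} (h : G.IsTrunk k f)
    (hm : 2 ≤ (G.edgesBetween (f 0) (f 1)).ncard)
    (huniq : ∀ e e' u v, e ≠ e' → G.IsLink e u v → G.IsLink e' u v → s(u, v) = s(f 0, f 1))
    (hk : Even k) {p q : α} (hp : ∀ i ≤ k, p ≠ f i) (hq : ∀ i ≤ k, q ≠ f i) (hpq : p ≠ q)
    (hkp : G.Adj (f k) p) (hkq : G.Adj (f k) q)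
    (hout : ∀ z, (∀ i ≤ k, z ≠ f i) → z ≠ p → z ≠ q →
      ¬ G.Adj (f k) z ∧ ¬ G.Adj p z ∧ ¬ G.Adj q z) : G.IsTilde := by
  have h2 := h.two_le
  -- The trunk is followed by `p` at index `k + 1` and by `q` at index `k + 2`.
  let f' : ℕ → α := fun i => if i ≤ k then f i else if i = k + 1 then p else q
  have f1 : ∀ i ≤ k, f' i = f i := fun i hi => if_pos hi
  have f2 : f' (k + 1) = p := by simp [f']
  have f3 : f' (k + 2) = q := by simp [f']
  have hcases : ∀ i < k + 3, i ≤ k ∨ i = k + 1 ∨ i = k + 2 := by omega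
  have hout' : ∀ z, (∀ i < k + 3, z ≠ f' i) → (∀ i ≤ k, z ≠ f i) ∧ z ≠ p ∧ z ≠ q := by
    intro z hz
    refine ⟨fun i hi => f1 i hi ▸ hz i (by omega), f2 ▸ hz (k + 1) (by omega),
      f3 ▸ hz (k + 2) (by omega)⟩
  have hV : ∀ z, z ∈ G.vertexSet ↔ ∃ i < k + 3, z = f' i := by
    intro z
    constructor
    · intro hz
      refine hconn.mem_of_closed (S := {z | ∃ i < k + 3, z = f' i}) (h.mem 0 (by omega))
        ⟨0, by omega, (f1 0 (by omega)).symm⟩ ?_ hz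
      rintro _ ⟨i, hi, rfl⟩ v hv
      by_contra hcon
      obtain ⟨h1, h2, h3⟩ := hout' v fun j hj hvj => hcon ⟨j, by omega, hvj⟩
      have ho := hout v h1 h2 h3
      rcases hcases i hi with hi | rfl | rfl
      · rw [f1 i hi] at hv
        rcases hi.lt_or_eq with hik | rfl
        · exact h.out v h1 i hik hv
        · exact ho.1 hv
      · exact ho.2.1 (f2 ▸ hv)
      · exact ho.2.2 (f3 ▸ hv)
    · rintro ⟨i, hi, rfl⟩
      rcases hcases i hi with hi | rfl | rfl
      · rw [f1 i hi]
        exact h.mem i hi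
      · rw [f2]
        exact hkp.right_mem
      · rw [f3]
        exact hkq.right_mem
  have hinj : ∀ i < k + 3, ∀ j < k + 3, f' i = f' j → i = j := by
    intro i hi j hj hij
    rcases hcases i hi with hi | rfl | rfl <;> rcases hcases j hj with hj | rfl | rfl
    · rw [f1 i hi, f1 j hj] at hij
      exact h.inj i hi j hj hij
    · rw [f1 i hi, f2] at hij
      exact absurd hij.symm (hp i hi)
    · rw [f1 i hi, f3] at hij
      exact absurd hij.symm (hq i hi)
    · rw [f1 j hj, f2] at hij
      exact absurd hij (hp j hj)
    · rfl
    · rw [f2, f3] at hij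
      exact absurd hij hpq
    · rw [f1 j hj, f3] at hij
      exact absurd hij (hq j hj)
    · rw [f2, f3] at hij
      exact absurd hij.symm hpq
    · rfl
  have h0 : f' 0 = f 0 := f1 0 (by omega)
  have h1 : f' 1 = f 1 := f1 1 (by omega)
  have hadj : ∀ i j, i < j → j < k + 3 → ¬ (i = 0 ∧ j = 2) → ¬ (i = 0 ∧ j = 1) →
      ¬ (i = k + 1 ∧ j = k + 2) →
      (G.Adj (f' i) (f' j) ↔ (1 ≤ i ∧ j ≤ k + 1 ∧ j = i + 1) ∨ (i = k ∧ j = k + 2)) := by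
    intro i j hij hj h02 h01 hlast
    rcases hcases j hj with hj' | rfl | rfl
    · rw [f1 i (by omega), f1 j hj']
      constructor
      · intro hadj
        have := h.eq_of_adj i j hij hj' h02 hadj
        omega
      · rintro (⟨h1, h2, rfl⟩ | h')
        · exact h.adj i h1 (by omega)
        · omega
    · rw [f1 i (by omega), f2]
      rcases (show i ≤ k by omega).lt_or_eq with hik | rfl
      · exact iff_of_false (h.out p hp i hik) (by omega)
      · exact iff_of_true hkp (by omega)
    · have hik : i ≤ k := by omega
      rw [f1 i hik, f3]
      rcases hik.lt_or_eq with hik | rfl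
      · exact iff_of_false (h.out q hq i hik) (by omega)
      · exact iff_of_true hkq (by omega)
  have hodd : Odd (k + 3) := hk.add_odd ⟨1, rfl⟩
  rw [← h0, ← h1] at hm huniq
  by_cases hpq' : G.Adj p q
  · have := isomorphic_withBundle_or hloop hE (n := k + 3)
      (S := pathEdges (k + 1) ∪ {s(k, k + 2), s(k + 1, k + 2)}) (f := f') (by omega) hinj hV
      (by
        rw [Set.mem_union, mk_mem_pathEdges (by omega)]
        simp only [Set.mem_insert_iff, Set.mem_singleton_iff, Sym2.eq_iff]
        omega)
      (by
        rw [Set.mem_union, mk_mem_pathEdges (by omega)]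
        simp only [Set.mem_insert_iff, Set.mem_singleton_iff, Sym2.eq_iff]
        omega)
      (fun i => by
        simp only [Set.mem_union, diag_notMem_pathEdges, Set.mem_insert_iff,
          Set.mem_singleton_iff, Sym2.eq_iff, false_or]
        omega) ?_ huniq
    · refine ⟨k + 3, _, hm, ?_⟩
      rcases this with h | h
      · exact Or.inr (Or.inr (Or.inl ⟨by omega, hodd, h⟩))
      · exact Or.inr (Or.inr (Or.inr (Or.inr (Or.inr ⟨by omega, hodd, h⟩))))
    · intro i j hij hj h01 h02
      simp only [Set.mem_union, mk_mem_pathEdges hij, Set.mem_insert_iff, Set.mem_singleton_iff,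
        Sym2.eq_iff]
      by_cases hlast : i = k + 1 ∧ j = k + 2
      · obtain ⟨rfl, rfl⟩ := hlast
        rw [f2, f3]
        exact iff_of_true hpq' (by omega)
      · rw [hadj i j hij hj h02 h01 hlast]
        omega
  · have := isomorphic_withBundle_or hloop hE (n := k + 3)
      (S := pathEdges (k + 1) ∪ {s(k, k + 2)}) (f := f') (by omega) hinj hV
      (by
        rw [Set.mem_union, mk_mem_pathEdges (by omega)]
        simp only [Set.mem_singleton_iff, Sym2.eq_iff]
        omega)
      (by
        rw [Set.mem_union, mk_mem_pathEdges (by omega)]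
        simp only [Set.mem_singleton_iff, Sym2.eq_iff]
        omega)
      (fun i => by
        simp only [Set.mem_union, diag_notMem_pathEdges, Set.mem_singleton_iff, Sym2.eq_iff,
          false_or]
        omega) ?_ huniq
    · refine ⟨k + 3, _, hm, ?_⟩
      rcases this with h | h
      · exact Or.inr (Or.inl ⟨by omega, hodd, h⟩)
      · exact Or.inr (Or.inr (Or.inr (Or.inr (Or.inl ⟨by omega, hodd, h⟩))))
    · intro i j hij hj h01 h02
      simp only [Set.mem_union, mk_mem_pathEdges hij, Set.mem_singleton_iff, Sym2.eq_iff]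
      by_cases hlast : i = k + 1 ∧ j = k + 2
      · obtain ⟨rfl, rfl⟩ := hlast
        rw [f2, f3]
        exact iff_of_false hpq' (by omega)
      · rw [hadj i j hij hj h02 h01 hlast]
        omega

/-- The only neighbour of the end of a trunk extends it. -/
theorem IsTrunk.extend {α β : Type*} {G : Graph α β} {k : ℕ} {f : ℕ → α} (h : G.IsTrunk k f) {p : α}
    (hp : ∀ i ≤ k, p ≠ f i) (hkp : G.Adj (f k) p)
    (hout : ∀ z, (∀ i ≤ k, z ≠ f i) → z ≠ p → ¬ G.Adj (f k) z) :
    G.IsTrunk (k + 1) (fun i => if i ≤ k then f i else p) := by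
  have h2 := h.two_le
  refine ⟨by omega, ?_, ?_, ?_, ?_, ?_⟩
  · intro i _
    by_cases hi : i ≤ k
    · simpa [hi] using h.mem i hi
    · simpa [hi] using hkp.right_mem
  · intro i hi j hj hij
    by_cases hi' : i ≤ k <;> by_cases hj' : j ≤ k <;> simp only [hi', hj', if_true, if_false] at hij
    · exact h.inj i hi' j hj' hij
    · exact absurd hij.symm (hp i hi')
    · exact absurd hij (hp j hj')
    · omega
  · intro i hi hik
    rcases (show i ≤ k by omega).lt_or_eq with hik' | rfl
    · simpa [hik'.le, Nat.succ_le_of_lt hik'] using h.adj i hi hik'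
    · simpa using hkp
  · intro i j hij hj h02 hadj
    have hi : i ≤ k := by omega
    by_cases hj' : j ≤ k
    · simp only [hi, hj', if_true] at hadj
      exact h.eq_of_adj i j hij hj' h02 hadj
    · simp only [hi, hj', if_true, if_false] at hadj
      rcases hi.lt_or_eq with hik | rfl
      · exact absurd hadj (h.out p hp i hik)
      · omega
  · intro z hz i hi hadj
    have hz1 : ∀ j ≤ k, z ≠ f j := fun j hj => by simpa [hj] using hz j (by omega)
    have hz2 : z ≠ p := by simpa using hz (k + 1) le_rfl
    have hik : i ≤ k := by omega
    simp only [hik, if_true] at hadj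
    rcases hik.lt_or_eq with hik | rfl
    · exact h.out z hz1 i hik hadj
    · exact hout z hz1 hz2 hadj

/-! ### The classification -/

/-- A connected graph in `𝒢*` with a trunk that starts with a bundle belongs to one of the six
families; `d` bounds the number of vertices outside the trunk. -/
theorem InGStar.isTilde_of_isTrunk {α β : Type*} {G : Graph α β} (hG : G.InGStar)
    (hV : G.vertexSet.Finite) (hE : G.edgeSet.Finite) (hloop : G.Loopless)
    (hconn : G.IsConnectedGraph) {a b : β} (hab : a ≠ b) (d : ℕ) :
    ∀ (k : ℕ) (f : ℕ → α), G.IsTrunk k f → G.IsLink a (f 0) (f 1) → G.IsLink b (f 0) (f 1) →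
      G.vertexSet.ncard ≤ k + d → G.IsTilde := by
  induction d with
  | zero =>
    intro k f h _ _ hd
    -- A trunk has `k + 1` distinct vertices, so the bound fails for `d = 0`.
    have hsub : f '' Set.Iic k ⊆ G.vertexSet := by
      rintro _ ⟨i, hi, rfl⟩
      exact h.mem i hi
    have hinj : Set.InjOn f (Set.Iic k) := fun i hi j hj hij => h.inj i hi j hj hij
    have hle := Set.ncard_le_ncard hsub hV
    rw [hinj.ncard_image, ← Finset.coe_Iic, Set.ncard_coe_finset, Nat.card_Iic] at hle
    omega
  | succ d ih =>
    intro k f h ha hb hd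
    have h2 := h.two_le
    have hm : 2 ≤ (G.edgesBetween (f 0) (f 1)).ncard := by
      rw [← Set.ncard_pair hab]
      refine Set.ncard_le_ncard ?_ (hE.subset fun e (he : G.IsLink e (f 0) (f 1)) => he.edge_mem)
      rintro e (rfl | rfl) <;> assumption
    have huniq : ∀ e e' u v, e ≠ e' → G.IsLink e u v → G.IsLink e' u v →
        s(u, v) = s(f 0, f 1) := fun e e' u v hne he he' =>
      hG.bundle_unique hV hE hloop hconn hab hne ha hb he he'
    by_cases hno : ∀ z, (∀ i ≤ k, z ≠ f i) → ¬ G.Adj (f k) z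
    · exact h.isTilde_of_no_neighbour hE hloop hconn hm huniq hno
    push Not at hno
    obtain ⟨p, hp, hkp⟩ := hno
    by_cases hone : ∀ z, (∀ i ≤ k, z ≠ f i) → z ≠ p → ¬ G.Adj (f k) z
    · refine ih (k + 1) _ (h.extend hp hkp hone) ?_ ?_ (by omega)
      · simpa [show 1 ≤ k by omega] using ha
      · simpa [show 1 ≤ k by omega] using hb
    push Not at hone
    obtain ⟨q, hq, hqp, hkq⟩ := hone
    have hsegV : f '' Set.Icc 2 k ⊆ G.vertexSet := by
      rintro _ ⟨i, hi, rfl⟩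
      exact h.mem i hi.2
    have hseg := h.connOn_segment h2 le_rfl
    have hkseg : f k ∈ f '' Set.Icc 2 k := ⟨k, ⟨h2, le_rfl⟩, rfl⟩
    have h2seg : f 2 ∈ f '' Set.Icc 2 k := ⟨2, ⟨le_rfl, h2⟩, rfl⟩
    have hnot : ∀ {i}, i < 2 → f i ∉ f '' Set.Icc 2 k := by
      rintro i hi ⟨j, hj, hij⟩
      have := h.inj j hj.2 i (by omega) hij
      have := hj.1
      omega
    have hout : ∀ {z}, (∀ i ≤ k, z ≠ f i) → z ∉ f '' Set.Icc 2 k := by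
      rintro z hz ⟨j, hj, rfl⟩
      exact hz j hj.2 rfl
    have h12 : G.Adj (f 2) (f 1) := (h.adj 1 le_rfl (by omega)).symm
    -- a connected set of even order with two attached vertices outside
    have false_of : ∀ {I : Set α} {q r : α}, f '' Set.Icc 2 k ⊆ I → I ⊆ G.vertexSet →
        G.ConnOn I → Even I.ncard → f 0 ∉ I → f 1 ∉ I → q ∉ I → r ∉ I → q ≠ r →
        (∀ i ≤ k, q ≠ f i) → (∀ i ≤ k, r ≠ f i) → (∃ w ∈ I, G.Adj w q) → (∃ w ∈ I, G.Adj w r) →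
        False := by
      rintro I q r hsI hIV hIc hIe h0 h1 hqI hrI hqr hq hr ⟨w, hw, hwq⟩ ⟨w', hw', hwr⟩
      -- Both branches use the end `f 1` of the bundle, which is attached to `I` through `f 2`.
      have hy := hIc.insert (hsI h2seg) h12
      have hattach : ∀ {w z}, w ∈ I → G.Adj w z → G.ConnOn (I ∪ {f 1, z}) := by
        intro w z hw hwz
        have := hy.insert (w := w) (by simp [hw]) hwz
        convert! this using 1
        ext t
        simp only [Set.mem_union, Set.mem_insert_iff, Set.mem_singleton_iff]
        tauto
      exact hG.false_of_branches hV hE (s := f 1) (t := f 1) hIV hwq.right_mem hwr.right_mem h0 h1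
        hqI hrI ha.ne (hq 0 (by omega)).symm (hr 0 (by omega)).symm (hq 1 (by omega)).symm
        (hr 1 (by omega)).symm hqr hab ha hb hIe (Or.inr rfl) (Or.inr rfl) hIc (hattach hw hwq)
        (hattach hw' hwr)
    rcases Nat.even_or_odd k with hk | hk
    · have hclosed : ∀ {p q : α}, (∀ i ≤ k, p ≠ f i) → (∀ i ≤ k, q ≠ f i) → q ≠ p →
          G.Adj (f k) p → G.Adj (f k) q → ∀ z, (∀ i ≤ k, z ≠ f i) → z ≠ p → z ≠ q →
          ¬ G.Adj (f k) z ∧ ¬ G.Adj p z := by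
        intro p q hp hq hqp hkp hkq z hz hzp hzq
        have key : ¬ ∃ w ∈ insert p (f '' Set.Icc 2 k), G.Adj w z := by
          intro hw
          refine false_of (I := insert p (f '' Set.Icc 2 k)) (q := q) (r := z)
            (Set.subset_insert _ _) (Set.insert_subset hkp.right_mem hsegV) (hseg.insert hkseg hkp)
            ?_ ?_ ?_ ?_ ?_ hzq.symm hq hz ⟨f k, by simp [hkseg], hkq⟩ hw
          · rw [Set.ncard_insert_of_notMem (hout hp) (hV.subset hsegV), h.ncard_segment]
            rwa [Nat.sub_add_cancel (by omega)]
          · rintro (h' | h')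
            · exact hp 0 (by omega) h'.symm
            · exact hnot (by omega) h'
          · rintro (h' | h')
            · exact hp 1 (by omega) h'.symm
            · exact hnot (by omega) h'
          · rintro (h' | h')
            · exact hqp h'
            · exact hout hq h'
          · rintro (h' | h')
            · exact hzp h'
            · exact hout hz h'
        exact ⟨fun h' => key ⟨f k, by simp [hkseg], h'⟩, fun h' => key ⟨p, by simp, h'⟩⟩
      refine h.isTilde_of_fork hE hloop hconn hm huniq hk hp hq hqp.symm hkp hkq ?_
      intro z hz hzp hzq
      exact ⟨(hclosed hp hq hqp hkp hkq z hz hzp hzq).1, (hclosed hp hq hqp hkp hkq z hz hzp hzq).2,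
        (hclosed hq hp hqp.symm hkq hkp z hz hzq hzp).2⟩
    -- For odd `k` the segment itself has even order `k - 1`, with branches `p` and `q`.
    · exact (false_of subset_rfl hsegV hseg (by rw [h.ncard_segment]; exact Nat.Odd.sub_odd hk odd_one)
        (hnot (by omega)) (hnot (by omega)) (hout hp) (hout hq) hqp.symm hp hq ⟨f k, hkseg, hkp⟩
        ⟨f k, hkseg, hkq⟩).elim

/-- The classification of the connected graphs in `𝒢*` with a bundle. -/
theorem InGStar.isTilde {α β : Type*} {G : Graph α β} (hG : G.InGStar)
    (hV : G.vertexSet.Finite) (hE : G.edgeSet.Finite) (hloop : G.Loopless)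
    (hconn : G.IsConnectedGraph) {a b : β} {x y : α} (hab : a ≠ b) (ha : G.IsLink a x y)
    (hb : G.IsLink b x y) : G.IsTilde := by
  by_cases hno : ∀ u ∈ ({x, y} : Set α), ∀ v, G.Adj u v → v ∈ ({x, y} : Set α)
  · have hVxy : ∀ z, z ∈ G.vertexSet ↔ ∃ i < 2, z = if i = 0 then x else y := by
      intro z
      constructor
      · intro hz
        rcases hconn.mem_of_closed ha.left_mem (by simp) hno hz with rfl | rfl
        · exact ⟨0, by omega, rfl⟩
        · exact ⟨1, by omega, rfl⟩
      · rintro ⟨i, hi, rfl⟩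
        split_ifs
        · exact ha.left_mem
        · exact ha.right_mem
    have hm : 2 ≤ (G.edgesBetween x y).ncard := by
      rw [← Set.ncard_pair hab]
      refine Set.ncard_le_ncard ?_ (hE.subset fun e (he : G.IsLink e x y) => he.edge_mem)
      rintro e (rfl | rfl) <;> assumption
    refine ⟨2, _, hm, Or.inl ⟨le_rfl, ?_⟩⟩
    refine isomorphic_withBundle hloop hE (f := fun i => if i = 0 then x else y) le_rfl ?_ hVxy
      (by simp) ?_ (fun i => diag_notMem_pathEdges) ?_ ?_
    · intro i hi j hj hij
      have := ha.ne
      by_cases h1 : i = 0 <;> by_cases h2 : j = 0 <;> simp only [h1, h2, if_true, if_false] at hij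
      · omega
      · exact absurd hij this
      · exact absurd hij.symm this
      · omega
    · rw [mk_mem_pathEdges (by omega)]
      omega
    · intro i j hij hj h01
      omega
    · intro e e' u v hne he he'
      simpa using hG.bundle_unique hV hE hloop hconn hab hne ha hb he he'
  push Not at hno
  -- at most one vertex outside is adjacent to an end of the bundle
  have hout : ∀ q r, q ∉ ({x, y} : Set α) → r ∉ ({x, y} : Set α) →
      (∃ s ∈ ({x, y} : Set α), G.Adj s q) → (∃ s ∈ ({x, y} : Set α), G.Adj s r) → q = r := by
    rintro q r hq hr ⟨s, hs, hsq⟩ ⟨t, ht, htr⟩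
    by_contra hqr
    simp only [Set.mem_insert_iff, Set.mem_singleton_iff, not_or] at hq hr
    refine hG.false_of_branches hV hE (I := ∅) (Set.empty_subset _) hsq.right_mem htr.right_mem
      id id id id ha.ne (Ne.symm hq.1) (Ne.symm hr.1) (Ne.symm hq.2) (Ne.symm hr.2) hqr hab ha hb
      (by simp) hs ht (connOn_empty G) ?_ ?_
    · rw [Set.empty_union]
      exact connOn_pair hsq
    · rw [Set.empty_union]
      exact connOn_pair htr
  -- The end of the bundle known to be adjacent to `w` becomes `f 1`. The other end may or may not
  -- be adjacent to `w = f 2`.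
  have hnt : ∀ {x y w : α}, (∀ q r, q ∉ ({x, y} : Set α) → r ∉ ({x, y} : Set α) →
      (∃ s ∈ ({x, y} : Set α), G.Adj s q) → (∃ s ∈ ({x, y} : Set α), G.Adj s r) → q = r) →
      w ∉ ({x, y} : Set α) → G.Adj y w → G.IsLink a x y → G.IsLink b x y → G.IsTilde := by
    intro x y w hout hw hyw ha hb
    simp only [Set.mem_insert_iff, Set.mem_singleton_iff, not_or] at hw
    have hxy := ha.ne
    have htrunk : G.IsTrunk 2 (fun i => if i = 0 then x else if i = 1 then y else w) := by
      refine ⟨le_rfl, ?_, ?_, ?_, ?_, ?_⟩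
      · intro i _
        split_ifs
        · exact ha.left_mem
        · exact ha.right_mem
        · exact hyw.right_mem
      · intro i hi j hj hij
        revert hij
        interval_cases i <;> interval_cases j <;>
          simp [hxy, hxy.symm, hw.1, hw.2, Ne.symm hw.1, Ne.symm hw.2]
      · intro i h1 h2
        obtain rfl : i = 1 := by omega
        simpa using hyw
      · intro i j hij hj h02 _
        omega
      · intro z hz i hi hadj
        have hz0 : z ≠ x := by simpa using hz 0 (by omega)
        have hz1 : z ≠ y := by simpa using hz 1 (by omega)
        have hz2 : z ≠ w := by simpa using hz 2 (by omega)
        refine hz2 (hout z w (by simp [hz0, hz1]) (by simp [hw]) ?_ ⟨y, by simp, hyw⟩)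
        refine ⟨_, ?_, hadj⟩
        interval_cases i <;> simp
    exact hG.isTilde_of_isTrunk hV hE hloop hconn hab G.vertexSet.ncard 2 _ htrunk (by simpa using ha)
      (by simpa using hb) (by omega)
  obtain ⟨u, hu, w, huw, hw⟩ := hno
  rcases hu with rfl | rfl
  · rw [Set.pair_comm] at hout hw
    exact hnt hout hw huw ha.symm hb.symm
  · exact hnt hout hw huw ha hb

end Graph

theorem theorem4p2 {α β : Type*} (G : Graph α β) (hV : G.vertexSet.Finite)
    (hE : G.edgeSet.Finite) (hloopless : G.Loopless) (hconn : G.IsConnectedGraph)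
    (hnonsimple : ¬ G.Simple) (hG : G.InGStar) :
    ∃ n m : ℕ, 2 ≤ m ∧
      ((2 ≤ n ∧ G.Isomorphic (Graph.tildeP n m)) ∨
        (5 ≤ n ∧ Odd n ∧ G.Isomorphic (Graph.tildeS n m)) ∨
        (5 ≤ n ∧ Odd n ∧ G.Isomorphic (Graph.tildeT n m)) ∨
        (3 ≤ n ∧ G.Isomorphic (Graph.tildeP' n m)) ∨
        (5 ≤ n ∧ Odd n ∧ G.Isomorphic (Graph.tildeS' n m)) ∨
        (5 ≤ n ∧ Odd n ∧ G.Isomorphic (Graph.tildeT' n m))) := by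
  obtain ⟨a, b, x, y, hab, ha, hb⟩ :
      ∃ a b x y, a ≠ b ∧ G.IsLink a x y ∧ G.IsLink b x y := by
    by_contra hcon
    push Not at hcon
    -- For a loopless graph, simplicity fails only through two distinct parallel edges.
    exact hnonsimple ⟨fun e f x y he hf => by_contra fun hne => hcon e f x y hne he hf⟩
  exact hG.isTilde hV hE hloopless hconn hab ha hb
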